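/- Let $X$ be a locally compact Hausdorff space and let $A$ be a $C_0(X)$-algebra, i.e. a C*-algebra with a $*$-homomorphism $\mu_A : C_0(X) \to ZM(A)$ into the centre of its multiplier algebra such that $\mu_A(C_0(X))A = A$. For $x \in X$ let $J_x = \mu_A(\{f \in C_0(X) : f(x) = 0\})A$, $A_x = A/J_x$, $a(x) = a + J_x$, and let $X_A = \{x \in X : J_x \neq A\}$. The map $\mu_A$ extends uniquely to a unital $*$-homomorphism $\mu_{M(A)} : C(\beta X) \to ZM(A)$; for $y \in \beta X$ let $H_y = \mu_{M(A)}(\{f \in C(\beta X) : f(y) = 0\})M(A)$. There is a unique unital $*$-homomorphism $\nu_A : C(\beta X_A) \to ZM(A)$ with $(\nu_A(f)a)(x) = f(x)a(x)$ for all $f \in C(\beta X_A)$, $a \in A$, $x \in X_A$. For a compact Hausdorff space $K$, a $C(K)$-algebra is a C*-algebra $B$ with a unital $*$-homomorphism $\mu_B : C(K) \to ZM(B)$; its fibre at $y \in K$ is $B_y = B/\mu_B(\{f : f(y) = 0\})B$, and it is continuous if $y \mapsto \|b(y)\|$ is continuous on $K$ for every $b \in B$. Put $$A^\beta = \bigcap_{x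 \in X_A} (A + H_x) \subseteq M(A).$$ Then $A^\beta$ is a norm-closed ideal of $M(A)$ containing $A$, and the following hold. (i) There is an injective $*$-homomorphism $\pi : ZM(A) \to ZM(A^\beta)$ with $\pi(z)b = zb$ for $z \in ZM(A)$, $b \in A^\beta$, and $\mu_{A^\beta} = \pi \circ \nu_A$ makes $A^\beta$ a $C(\beta X_A)$-algebra. If $K$ is any compactification of $X_A$ and $C(K)$ is regarded as a subalgebra of $C(\beta X_A)$ by restricting functions to $X_A$ and extending them to $\beta X_A$, then the restriction $\mu^K_{A^\beta}$ of $\mu_{A^\beta}$ to $C(K)$ makes $A^\beta$ a $C(K)$-algebra. (ii) For every compactification $K$ of $X_A$, the $C(K)$-algebra $(A^\beta, K, \mu^K_{A^\beta})$, with the inclusion $A \subseteq A^\beta$, is a compactification of $A$: the inclusion is $C(K)$-linear (where $C(K)$ acts on $A$ through the restriction of $\nu_A$ to $C(K)$), $A$ is an essential ideal of $A^\beta$, and for every $x \in X_A$ the inclusion induces a $*$-isomorphism of $A_x$ onto the fibre of $(A^\beta, K, \mu^K_{A^\beta})$ at $x$. (iii) If $X_A = X$ and $A$ is a continuous $C_0(X)$-algebra,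 i.e. $x \mapsto \|a(x)\|$ is continuous on $X$ for every $a \in A$, then $(A^\beta, \beta X_A, \mu_{A^\beta})$ is a continuous $C(\beta X)$-algebra. -/

import Mathlib

open Set Topology
open scoped ZeroAtInfty MultiplierAlgebra

noncomputable section

namespace BundleCompactification

universe u v w

set_option linter.unusedSectionVars false

/-! ### Closed ideals and quotients

The algebras below are `*`-algebras over `ℂ` with a norm satisfying the C*-identity; such an algebra
is a C*-algebra exactly when it is moreover complete. -/

section Ideals

variable {B : Type v} [NonUnitalNormedRing B] [StarRing B] [CStarRing B] [NormedSpace ℂ B]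
  [IsScalarTower ℂ B B] [SMulCommClass ℂ B B] [StarModule ℂ B]

variable (B) in
/-- A norm-closed two-sided self-adjoint ideal. -/
structure ClosedIdeal extends Submodule ℂ B where
  mul_left_mem : ∀ (b : B) {c : B}, c ∈ toSubmodule → b * c ∈ toSubmodule
  mul_right_mem : ∀ (b : B) {c : B}, c ∈ toSubmodule → c * b ∈ toSubmodule
  star_mem : ∀ {c : B}, c ∈ toSubmodule → star c ∈ toSubmodule
  closed : IsClosed (toSubmodule : Set B)

instance : Membership B (ClosedIdeal B) := ⟨fun I b => b ∈ I.toSubmodule⟩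

/-- The closed linear span of a set which is stable under multiplications and the involution. -/
def ClosedIdeal.closedSpan (G : Set B) (hl : ∀ b, ∀ c ∈ G, b * c ∈ G) (hr : ∀ b, ∀ c ∈ G, c * b ∈ G)
    (hs : ∀ c ∈ G, star c ∈ G) : ClosedIdeal B where
  toSubmodule := (Submodule.span ℂ G).topologicalClosure
  mul_left_mem b c hc := by
    refine map_mem_closure (f := fun x => b * x) (by fun_prop) hc fun x hx => ?_
    refine Submodule.span_induction (fun y hy => Submodule.subset_span (hl b y hy)) (by simp)
      (fun y z _ _ hy hz => ?_) (fun t y _ hy => ?_) hx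
    · simpa only [mul_add] using! Submodule.add_mem _ hy hz
    · simpa only [mul_smul_comm] using! Submodule.smul_mem _ t hy
  mul_right_mem b c hc := by
    refine map_mem_closure (f := fun x => x * b) (by fun_prop) hc fun x hx => ?_
    refine Submodule.span_induction (fun y hy => Submodule.subset_span (hr b y hy)) (by simp)
      (fun y z _ _ hy hz => ?_) (fun t y _ hy => ?_) hx
    · simpa only [add_mul] using! Submodule.add_mem _ hy hz
    · simpa only [smul_mul_assoc] using! Submodule.smul_mem _ t hy
  star_mem {c} hc := by
    refine map_mem_closure (f := fun x : B => star x) continuous_star hc fun x hx => ?_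
    refine Submodule.span_induction (fun y hy => Submodule.subset_span (hs y hy)) (by simp)
      (fun y z _ _ hy hz => ?_) (fun t y _ hy => ?_) hx
    · simpa only [star_add] using! Submodule.add_mem _ hy hz
    · simpa only [star_smul] using! Submodule.smul_mem _ _ hy
  closed := Submodule.isClosed_topologicalClosure _

/-- The quotient `B / I`. -/
def ClosedIdeal.Quot (I : ClosedIdeal B) : Type v := B ⧸ I.toSubmodule

namespace ClosedIdeal

variable (I : ClosedIdeal B)

/-- The quotient norm on `B / I`. -/
instance : NormedAddCommGroup I.Quot :=
  haveI := I.closed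
  inferInstanceAs (NormedAddCommGroup (B ⧸ I.toSubmodule))

instance : Module ℂ I.Quot := inferInstanceAs (Module ℂ (B ⧸ I.toSubmodule))

/-- The quotient map `B → B / I`. -/
def proj (b : B) : I.Quot := Submodule.Quotient.mk (p := I.toSubmodule) b

instance : Mul I.Quot where
  mul := Quotient.map₂ (· * ·) fun a a' ha b b' hb => by
    replace ha : a - a' ∈ I.toSubmodule := (Submodule.quotientRel_def _).1 ha
    replace hb : b - b' ∈ I.toSubmodule := (Submodule.quotientRel_def _).1 hb
    refine (Submodule.quotientRel_def _).2 ?_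
    have h : a * b - a' * b' = (a - a') * b + a' * (b - b') := by noncomm_ring
    simpa only [h] using! I.add_mem (I.mul_right_mem b ha) (I.mul_left_mem a' hb)

instance : Star I.Quot where
  star := Quotient.map star fun a a' ha => by
    replace ha : a - a' ∈ I.toSubmodule := (Submodule.quotientRel_def _).1 ha
    refine (Submodule.quotientRel_def _).2 ?_
    simpa only [star_sub] using! I.star_mem ha

theorem proj_mul (a b : B) : I.proj (a * b) = I.proj a * I.proj b := rfl
theorem proj_star (a : B) : I.proj (star a) = star (I.proj a) := rfl
theorem proj_add (a b : B) : I.proj (a + b) = I.proj a + I.proj b := rfl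
theorem proj_smul (t : ℂ) (a : B) : I.proj (t • a) = t • I.proj a := rfl

end ClosedIdeal

end Ideals

/-! ### Central multipliers -/

section Multipliers

variable (B : Type v) [NonUnitalNormedRing B] [StarRing B] [CStarRing B] [NormedSpace ℂ B]
  [IsScalarTower ℂ B B] [SMulCommClass ℂ B B] [StarModule ℂ B]

/-- `Z M(B)`, the centre of the multiplier algebra `M(B)`. -/
def ZM : StarSubalgebra ℂ 𝓜(ℂ, B) where
  __ := Subalgebra.center ℂ 𝓜(ℂ, B)
  star_mem' h := Set.star_mem_center h

variable {B}

/-- The product `z b ∈ B` of `z ∈ Z M(B)` and `b ∈ B`. -/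
def ZM.cmul (z : ZM B) (b : B) : B := (z : 𝓜(ℂ, B)).fst b

theorem ZM.comm (z : ZM B) (m : 𝓜(ℂ, B)) : m * z = z * m :=
  Subalgebra.mem_center_iff.1 z.2 m

theorem ZM.cmul_mul (z : ZM B) (b c : B) : ZM.cmul z (b * c) = ZM.cmul z b * c := by
  rw [← sub_eq_zero, ← CStarRing.star_mul_self_eq_zero_iff]
  have h : ∀ d, d * (ZM.cmul z (b * c) - ZM.cmul z b * c) = 0 := fun d => by
    rw [mul_sub, ← mul_assoc]
    simp only [ZM.cmul, ← (z : 𝓜(ℂ, B)).central, mul_assoc, sub_self]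
  exact h _

/-- A central multiplier acts in the same way from the left and from the right. -/
theorem ZM.cmul_eq_snd (z : ZM B) (b : B) : ZM.cmul z b = (z : 𝓜(ℂ, B)).snd b := by
  rw [← sub_eq_zero, ← CStarRing.mul_star_self_eq_zero_iff]
  have h : ∀ d, (ZM.cmul z b - (z : 𝓜(ℂ, B)).snd b) * d = 0 := fun d => by
    have h := congrArg (fun m : 𝓜(ℂ, B) => m.fst d) (ZM.comm z (b : 𝓜(ℂ, B)))
    replace h : b * ZM.cmul z d = ZM.cmul z (b * d) := h
    rw [sub_mul, ← ZM.cmul_mul, ← h, (z : 𝓜(ℂ, B)).central]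
    exact sub_self _
  exact h _

theorem ZM.mul_cmul (z : ZM B) (b c : B) : b * ZM.cmul z c = ZM.cmul z (b * c) := by
  rw [ZM.cmul_mul, ZM.cmul_eq_snd z b, (z : 𝓜(ℂ, B)).central]
  rfl

theorem ZM.star_cmul (z : ZM B) (b : B) : star (ZM.cmul z b) = ZM.cmul (star z) (star b) := by
  rw [ZM.cmul_eq_snd]
  change _ = star ((z : 𝓜(ℂ, B)).snd (star (star b)))
  rw [star_star]

/-- The ideal `T B`, i.e. the closed linear span of the products `z b` with `z ∈ T` and `b ∈ B`,
for a self-adjoint set `T` of central multipliers of `B`. -/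
def mulIdeal (T : Set (ZM B)) (hT : ∀ z ∈ T, star z ∈ T) : ClosedIdeal B :=
  ClosedIdeal.closedSpan {c | ∃ z ∈ T, ∃ b : B, c = ZM.cmul z b}
    (by rintro b _ ⟨z, hz, c, rfl⟩; exact ⟨z, hz, b * c, ZM.mul_cmul z b c⟩)
    (by rintro b _ ⟨z, hz, c, rfl⟩; exact ⟨z, hz, c * b, (ZM.cmul_mul z c b).symm⟩)
    (by rintro _ ⟨z, hz, c, rfl⟩; exact ⟨star z, hT z hz, star c, ZM.star_cmul z c⟩)

end Multipliers

/-! ### `C(K)`-algebras -/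

section Compact

variable {K : Type w} [TopologicalSpace K] {B : Type v} [NonUnitalNormedRing B] [StarRing B]
  [CStarRing B] [NormedSpace ℂ B] [IsScalarTower ℂ B B] [SMulCommClass ℂ B B] [StarModule ℂ B]

/-- `(B, K, μ)` is a `C(K)`-algebra: `K` is compact Hausdorff, `B` is a C*-algebra, and `μ` is a
unital `*`-homomorphism from `C(K)` to `Z M(B)`; hence `μ(C(K)) B = B`. -/
structure IsCKAlgebra (μ : C(K, ℂ) →⋆ₐ[ℂ] ZM B) : Prop where
  compact : CompactSpace K
  t2 : T2Space K
  complete : CompleteSpace B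
  nondegenerate : ∀ b : B, ∃ (f : C(K, ℂ)) (c : B), b = ZM.cmul (μ f) c

/-- The ideal `μ({f ∈ C(K) : f(y) = 0}) B` of `B`. -/
def ckIdeal (μ : C(K, ℂ) →⋆ₐ[ℂ] ZM B) (y : K) : ClosedIdeal B :=
  mulIdeal {z | ∃ f : C(K, ℂ), f y = 0 ∧ z = μ f} (by
    rintro _ ⟨f, hf, rfl⟩
    exact ⟨star f, by simp [hf], (map_star μ f).symm⟩)

/-- `(B, K, μ)` is continuous: `y ↦ ‖b(y)‖` is continuous on `K` for all `b ∈ B`, where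
`b(y) = b + ckIdeal μ y`. -/
def IsContinuousCK (μ : C(K, ℂ) →⋆ₐ[ℂ] ZM B) : Prop :=
  ∀ b : B, Continuous fun y => ‖(ckIdeal μ y).proj b‖

end Compact

/-! ### `C₀(X)`-algebras -/

/-- The structure of a `C₀(X)`-algebra on the C*-algebra `A`: a `*`-homomorphism
`μ : C₀(X) → Z M(A)` such that `μ(C₀(X)) A` is dense in (equivalently, by Cohen factorization, equal
to) `A`. -/
structure C0Algebra (X : Type u) [TopologicalSpace X] (A : Type v) [NonUnitalCStarAlgebra A] where
  μ : C₀(X, ℂ) →⋆ₙₐ[ℂ] ZM A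
  nondegenerate :
    (Submodule.span ℂ {b : A | ∃ (f : C₀(X, ℂ)) (a : A), b = ZM.cmul (μ f) a}).topologicalClosure = ⊤

section C0

variable {X : Type u} [TopologicalSpace X] {A : Type v} [NonUnitalCStarAlgebra A]

namespace C0Algebra

variable (D : C0Algebra X A)

/-- The ideal `J_x = μ({f ∈ C₀(X) : f(x) = 0}) A` of `A`. -/
def J (x : X) : ClosedIdeal A :=
  mulIdeal {z | ∃ f : C₀(X, ℂ), f x = 0 ∧ z = D.μ f} (by
    rintro _ ⟨f, hf, rfl⟩
    exact ⟨star f, by simp [hf], (map_star D.μ f).symm⟩)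

/-- The set `X_A` of the points `x ∈ X` with `J_x ≠ A`. -/
def XA : Set X := {x | (D.J x).toSubmodule ≠ ⊤}

/-- `A` is a continuous `C₀(X)`-algebra: `x ↦ ‖a(x)‖` is continuous on `X` for all `a ∈ A`, where
`a(x) = a + J_x`. -/
def IsContinuous : Prop := ∀ a : A, Continuous fun x => ‖(D.J x).proj a‖

/-- `μM : C(βX) → Z M(A)` extends `μ : C₀(X) → Z M(A)`, where `C₀(X)` is regarded as a subset of
`C(βX)`. -/
def Extends (μM : C(StoneCech X, ℂ) →⋆ₐ[ℂ] ZM A) : Prop :=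
  ∀ (f : C(StoneCech X, ℂ)) (g : C₀(X, ℂ)), (∀ x, f (stoneCechUnit x) = g x) → μM f = D.μ g

/-- For a compact Hausdorff space `K` and an embedding `ι : X_A → K`, the structure map `μK` is that
of the `C(K)`-algebra which `A` becomes by regarding its base map as a map to `K`: on sections over
`X_A`, `μK f` is the multiplication by `f ∘ ι`. -/
def IsBaseChange {K : Type w} [TopologicalSpace K] (ι : D.XA → K)
    (μK : C(K, ℂ) →⋆ₐ[ℂ] ZM A) : Prop :=
  ∀ (f : C(K, ℂ)) (a : A) (x : D.XA), (D.J x).proj (ZM.cmul (μK f) a) = f (ι x) • (D.J x).proj a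

/-- `(B, K, μB)` together with `Ψ : A → B` is a compactification of the `C₀(X)`-algebra `A`. Here
`ι` is the embedding of `X_A` into `K`, and `μAK` the resulting `C(K)`-structure of `A`. -/
structure IsCompactification {K : Type w} [TopologicalSpace K] (ι : D.XA → K)
    (μAK : C(K, ℂ) →⋆ₐ[ℂ] ZM A)
    {B : Type v} [NonUnitalNormedRing B] [StarRing B] [CStarRing B] [NormedSpace ℂ B]
    [IsScalarTower ℂ B B] [SMulCommClass ℂ B B] [StarModule ℂ B]
    (μB : C(K, ℂ) →⋆ₐ[ℂ] ZM B) (Ψ : A →⋆ₙₐ[ℂ] B) : Prop where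
  isCKAlgebra : IsCKAlgebra μB
  isDenseEmbedding : IsDenseEmbedding ι
  isBaseChange : D.IsBaseChange ι μAK
  injective : Function.Injective Ψ
  linear : ∀ (f : C(K, ℂ)) (a : A), Ψ (ZM.cmul (μAK f) a) = ZM.cmul (μB f) (Ψ a)
  ideal_left : ∀ (b : B) (a : A), b * Ψ a ∈ Set.range Ψ
  ideal_right : ∀ (b : B) (a : A), Ψ a * b ∈ Set.range Ψ
  essential : ∀ b : B, (∀ a : A, b * Ψ a = 0) → b = 0
  /-- The induced maps `Ψ_x : A_x → B_x` are `*`-isomorphisms for all `x ∈ X_A`. -/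
  fibre : ∀ x : D.XA, ∃ Ψx : (D.J x).Quot ≃⋆ₐ[ℂ] (ckIdeal μB (ι x)).Quot,
    ∀ a : A, Ψx ((D.J x).proj a) = (ckIdeal μB (ι x)).proj (Ψ a)

section Beta

variable (μM : C(StoneCech X, ℂ) →⋆ₐ[ℂ] ZM A)

/-- The ideal `H_y = μM({f ∈ C(βX) : f(y) = 0}) M(A)` of `M(A)`, for `y ∈ βX`. -/
def H (y : StoneCech X) : ClosedIdeal 𝓜(ℂ, A) :=
  ClosedIdeal.closedSpan
    {k | ∃ f : C(StoneCech X, ℂ), f y = 0 ∧ ∃ m : 𝓜(ℂ, A), k = (μM f : 𝓜(ℂ, A)) * m}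
    (by
      rintro n _ ⟨f, hf, m, rfl⟩
      exact ⟨f, hf, n * m, by rw [← mul_assoc, ZM.comm, mul_assoc]⟩)
    (by
      rintro n _ ⟨f, hf, m, rfl⟩
      exact ⟨f, hf, m * n, by rw [mul_assoc]⟩)
    (by
      rintro _ ⟨f, hf, m, rfl⟩
      refine ⟨star f, by simp [hf], star m, ?_⟩
      rw [star_mul, map_star, ← ZM.comm]
      rfl)

/-- `A^β`, the intersection of the sets `A + H_x` with `x ∈ X_A`, inside `M(A)`. -/
def beta : NonUnitalStarSubalgebra ℂ 𝓜(ℂ, A) where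
  carrier := {m | ∀ x ∈ D.XA, ∃ a : A, ∃ h ∈ H μM (stoneCechUnit x), m = (a : 𝓜(ℂ, A)) + h}
  add_mem' := by
    intro m n hm hn x hx
    obtain ⟨a, h, hh, rfl⟩ := hm x hx
    obtain ⟨b, k, hk, rfl⟩ := hn x hx
    refine ⟨a + b, h + k, Submodule.add_mem _ hh hk, ?_⟩
    rw [show ((a + b : A) : 𝓜(ℂ, A)) = a + b from map_add (DoubleCentralizer.coeHom (𝕜 := ℂ)) a b]
    abel
  zero_mem' := fun x _ => ⟨0, 0, Submodule.zero_mem _, by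
    rw [add_zero]; exact (map_zero (DoubleCentralizer.coeHom (𝕜 := ℂ) (A := A))).symm⟩
  smul_mem' := by
    intro t m hm x hx
    obtain ⟨a, h, hh, rfl⟩ := hm x hx
    refine ⟨t • a, t • h, Submodule.smul_mem _ t hh, ?_⟩
    rw [smul_add]
    exact congrArg (· + t • h) (map_smul (DoubleCentralizer.coeHom (𝕜 := ℂ) (A := A)) t a).symm
  mul_mem' := by
    intro m n hm hn x hx
    obtain ⟨a, h, hh, rfl⟩ := hm x hx
    obtain ⟨b, k, hk, rfl⟩ := hn x hx
    refine ⟨a * b, h * (b + k) + a * k, Submodule.add_mem _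
      ((H μM _).mul_right_mem _ hh) ((H μM _).mul_left_mem _ hk), ?_⟩
    rw [show ((a * b : A) : 𝓜(ℂ, A)) = a * b from map_mul (DoubleCentralizer.coeHom (𝕜 := ℂ)) a b]
    noncomm_ring
  star_mem' := by
    intro m hm x hx
    obtain ⟨a, h, hh, rfl⟩ := hm x hx
    refine ⟨star a, star h, (H μM _).star_mem hh, ?_⟩
    rw [star_add]
    exact congrArg (· + star h) (map_star (DoubleCentralizer.coeHom (𝕜 := ℂ) (A := A)) a).symm

instance : CStarRing (D.beta μM) where
  norm_mul_self_le b := CStarRing.norm_mul_self_le (b : 𝓜(ℂ, A))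

/-- The inclusion of `A` into `A^β`. -/
def toBeta : A →⋆ₙₐ[ℂ] D.beta μM :=
  NonUnitalStarAlgHom.codRestrict (DoubleCentralizer.coeHom (𝕜 := ℂ)) (D.beta μM)
    fun a _ _ => ⟨a, 0, Submodule.zero_mem _, (add_zero _).symm⟩

end Beta

/-- The homomorphism `C(K) → C(βX_A)` that takes `f` to the continuous extension of `f ∘ ι`. -/
def restrictToBeta {K : Type w} [TopologicalSpace K] [CompactSpace K] [T2Space K] {ι : D.XA → K}
    (hι : Continuous ι) : C(K, ℂ) →⋆ₐ[ℂ] C(StoneCech D.XA, ℂ) :=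
  ContinuousMap.compStarAlgHom' ℂ ℂ ⟨stoneCechExtend hι, continuous_stoneCechExtend hι⟩

end C0Algebra

end C0

end BundleCompactification

end

open BundleCompactification

section

open Set Topology Filter
open scoped ZeroAtInfty MultiplierAlgebra

namespace BundleCompactification

universe u v w

set_option linter.unusedSectionVars false

/-! ### Quotient norms of closed ideals. -/

section Ideals

variable {B : Type v} [NonUnitalNormedRing B] [StarRing B] [CStarRing B] [NormedSpace ℂ B]
  [IsScalarTower ℂ B B] [SMulCommClass ℂ B B] [StarModule ℂ B]

namespace ClosedIdeal

variable (I : ClosedIdeal B)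

/-! Elements of `A` are treated as sections over `X_A`. Adjoining a point at infinity turns `A` into
a `C(X ∪ {∞})`-algebra with zero fibre at `∞`. A partition of unity combined with repeated squaring
then shows that the norm of `A` is the supremum of the fibre norms over `X_A`
(`norm_le_of_forall_norm_proj_le`). So identities in `A` can be checked fibrewise, and uniform
limits of sections exist. Since `‖a(x)‖ ≥ ε` only on a compact subset of `X_A`, Tietze's theorem
approximates the section `f a` for `f ∈ C(βX_A)`. This gives `ν_A` (`betaMap`), and its restriction
to `C(βX)` is `μ_{M(A)}`.

The central point is a local description of `H_x` for `x ∈ X_A`: it consists of the multipliers `m`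
with `‖(m a)(y)‖ → 0` as `y → x` in `X_A`, uniformly for `a` in the unit ball (`vanishingAt`,
`H_eq_vanishingAt`). One inclusion is an estimate on generators. For the other, a Urysohn function
`k` equal to `1` at `x` and supported near `x` makes `k m` small, so `m` is close to `(1 - k) m`.
This description refers only to the topology of `X_A`. Hence the same argument over any
compactification `K` shows that the fibre ideal of `A^β` at `x` is `A^β ∩ H_x`
(`mem_ckIdeal_beta_iff`). The fibre map is injective because `A ∩ H_x = J_x`, and surjective because
`A^β ⊆ A + H_x`. The quotient map `A_x → M(A)/H_x` is isometric, so `A + H_x` is closed.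

For continuity, an element of `A^β` is close to a section of `A` near each point of `X_A`, so its
fibre norm is continuous there. This function extends to `βX_A`, and the extension is the fibre norm
at every point: cut-off functions bound the fibre norm above by the extension, while upper
semicontinuity and density of `X_A` give the reverse bound. -/

theorem proj_sub (a b : B) : I.proj (a - b) = I.proj a - I.proj b := rfl

theorem proj_eq_zero_iff {b : B} : I.proj b = 0 ↔ b ∈ I.toSubmodule :=
  Submodule.Quotient.mk_eq_zero _

theorem proj_eq_proj_iff {a b : B} : I.proj a = I.proj b ↔ a - b ∈ I.toSubmodule :=
  Submodule.Quotient.eq _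

theorem proj_surjective : Function.Surjective I.proj := Submodule.Quotient.mk_surjective _

theorem norm_proj_le (b : B) : ‖I.proj b‖ ≤ ‖b‖ :=
  Submodule.Quotient.norm_mk_le (S := I.toSubmodule) b

theorem norm_proj_le_of_mem (b : B) {c : B} (hc : c ∈ I.toSubmodule) :
    ‖I.proj b‖ ≤ ‖b - c‖ := by
  have h : I.proj b = I.proj (b - c) := by
    rw [proj_eq_proj_iff]; simpa using hc
  rw [h]; exact I.norm_proj_le _

theorem exists_mem_norm_sub_lt {b : B} {r : ℝ} (h : ‖I.proj b‖ < r) :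
    ∃ c ∈ I.toSubmodule, ‖b - c‖ < r := by
  obtain ⟨d, hd, hdr⟩ := Submodule.Quotient.norm_mk_lt (I.proj b) (sub_pos.2 h)
  refine ⟨b - d, (I.proj_eq_proj_iff (a := b) (b := d)).1 hd.symm, ?_⟩
  rw [sub_sub_cancel]
  exact hdr.trans_eq (add_sub_cancel _ _)

theorem norm_proj_smul (t : ℂ) (b : B) : ‖I.proj (t • b)‖ = ‖t‖ * ‖I.proj b‖ :=
  norm_smul t (Submodule.Quotient.mk (p := I.toSubmodule) b)

theorem norm_proj_map_le (T : B →L[ℂ] B) (hT : ∀ c ∈ I.toSubmodule, T c ∈ I.toSubmodule) (b : B) :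
    ‖I.proj (T b)‖ ≤ ‖T‖ * ‖I.proj b‖ := by
  refine le_of_forall_pos_le_add fun ε hε => ?_
  obtain ⟨c, hc, hcr⟩ := I.exists_mem_norm_sub_lt
    (lt_add_of_pos_right ‖I.proj b‖ (show 0 < ε / (‖T‖ + 1) by positivity))
  calc ‖I.proj (T b)‖ ≤ ‖T b - T c‖ := I.norm_proj_le_of_mem _ (hT c hc)
    _ ≤ ‖T‖ * ‖b - c‖ := by rw [← map_sub]; exact T.le_opNorm _
    _ ≤ ‖T‖ * (‖I.proj b‖ + ε / (‖T‖ + 1)) := by gcongr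
    _ = ‖T‖ * ‖I.proj b‖ + ‖T‖ / (‖T‖ + 1) * ε := by ring
    _ ≤ ‖T‖ * ‖I.proj b‖ + 1 * ε := by
      gcongr
      rw [div_le_one (by positivity)]; linarith
    _ = _ := by ring

theorem norm_proj_mul_le (a b : B) : ‖I.proj (a * b)‖ ≤ ‖I.proj a‖ * ‖b‖ := by
  refine le_of_forall_pos_le_add fun ε hε => ?_
  obtain ⟨c, hc, hcr⟩ := I.exists_mem_norm_sub_lt
    (lt_add_of_pos_right ‖I.proj a‖ (show 0 < ε / (‖b‖ + 1) by positivity))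
  calc ‖I.proj (a * b)‖ ≤ ‖a * b - c * b‖ := I.norm_proj_le_of_mem _ (I.mul_right_mem b hc)
    _ ≤ ‖a - c‖ * ‖b‖ := by rw [← sub_mul]; exact norm_mul_le _ _
    _ ≤ (‖I.proj a‖ + ε / (‖b‖ + 1)) * ‖b‖ := by gcongr
    _ = ‖I.proj a‖ * ‖b‖ + ‖b‖ / (‖b‖ + 1) * ε := by ring
    _ ≤ ‖I.proj a‖ * ‖b‖ + 1 * ε := by
      gcongr
      rw [div_le_one (by positivity)]; linarith
    _ = _ := by ring

/-- The seminorm `b ↦ ‖b + I‖`. -/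
noncomputable def seminorm : Seminorm ℂ B :=
  Seminorm.ofSMulLE (fun b => ‖I.proj b‖) (norm_zero (E := I.Quot))
    (fun a b => norm_add_le (I.proj a) (I.proj b)) fun t b => (I.norm_proj_smul t b).le

@[simp] theorem seminorm_apply (b : B) : I.seminorm b = ‖I.proj b‖ := rfl

/-- The common pattern for bounding `ckIdeal`, `J` and `H` from above: a closed subspace need only
be tested on generators. -/
theorem le_of_eq_topologicalClosure {I : ClosedIdeal B} {G : Set B} {S : Submodule ℂ B}
    (hI : I.toSubmodule = (Submodule.span ℂ G).topologicalClosure)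
    (hS : IsClosed (S : Set B)) (h : G ⊆ S) : I.toSubmodule ≤ S := by
  rw [hI]
  exact Submodule.topologicalClosure_minimal _ (Submodule.span_le.2 h) hS

end ClosedIdeal

end Ideals

/-- A double centralizer of a C*-algebra is determined by its left part. -/
theorem doubleCentralizer_ext_fst {B : Type v} [NonUnitalNormedRing B] [StarRing B] [CStarRing B]
    [NormedSpace ℂ B] [IsScalarTower ℂ B B] [SMulCommClass ℂ B B] {m n : 𝓜(ℂ, B)}
    (h : ∀ a, m.fst a = n.fst a) : m = n := by
  refine DoubleCentralizer.ext _ _ _ _ (Prod.ext (ContinuousLinearMap.ext h) ?_)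
  refine ContinuousLinearMap.ext fun a => ?_
  rw [← sub_eq_zero, ← CStarRing.mul_star_self_eq_zero_iff]
  have h : ∀ d, (m.snd a - n.snd a) * d = 0 := fun d => by
    rw [sub_mul, m.central, n.central, h, sub_self]
  exact h _

theorem ZM.ext_cmul {B : Type v} [NonUnitalNormedRing B] [StarRing B] [CStarRing B]
    [NormedSpace ℂ B] [IsScalarTower ℂ B B] [SMulCommClass ℂ B B] [StarModule ℂ B] {z z' : ZM B}
    (h : ∀ b, ZM.cmul z b = ZM.cmul z' b) : z = z' :=
  Subtype.ext (doubleCentralizer_ext_fst h)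

/-! ### Generators of the fibre ideals. -/

section Generators

variable {B : Type v} [NonUnitalNormedRing B] [StarRing B] [CStarRing B] [NormedSpace ℂ B]
  [IsScalarTower ℂ B B] [SMulCommClass ℂ B B] [StarModule ℂ B]
  {K : Type w} [TopologicalSpace K] (μ : C(K, ℂ) →⋆ₐ[ℂ] ZM B) (y : K)

theorem ckIdeal_le {S : Submodule ℂ B} (hS : IsClosed (S : Set B))
    (h : ∀ f : C(K, ℂ), f y = 0 → ∀ b, ZM.cmul (μ f) b ∈ S) : (ckIdeal μ y).toSubmodule ≤ S := by
  refine ClosedIdeal.le_of_eq_topologicalClosure rfl hS ?_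
  rintro _ ⟨_, ⟨f, hf, rfl⟩, b, rfl⟩
  exact h f hf b

theorem cmul_mem_ckIdeal {f : C(K, ℂ)} (hf : f y = 0) (b : B) :
    ZM.cmul (μ f) b ∈ (ckIdeal μ y).toSubmodule :=
  Submodule.le_topologicalClosure _ (Submodule.subset_span ⟨_, ⟨f, hf, rfl⟩, b, rfl⟩)

variable {X : Type u} [TopologicalSpace X] {A : Type v} [NonUnitalCStarAlgebra A]
  (D : C0Algebra X A)

theorem C0Algebra.J_le (x : X) {S : Submodule ℂ A} (hS : IsClosed (S : Set A))
    (h : ∀ f : C₀(X, ℂ), f x = 0 → ∀ a, ZM.cmul (D.μ f) a ∈ S) : (D.J x).toSubmodule ≤ S := by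
  refine ClosedIdeal.le_of_eq_topologicalClosure rfl hS ?_
  rintro _ ⟨_, ⟨f, hf, rfl⟩, b, rfl⟩
  exact h f hf b

theorem C0Algebra.cmul_mem_J (x : X) {f : C₀(X, ℂ)} (hf : f x = 0) (a : A) :
    ZM.cmul (D.μ f) a ∈ (D.J x).toSubmodule :=
  Submodule.le_topologicalClosure _ (Submodule.subset_span ⟨_, ⟨f, hf, rfl⟩, a, rfl⟩)

theorem C0Algebra.mem_of_nondegenerate {S : Submodule ℂ A} (hS : IsClosed (S : Set A))
    (h : ∀ (f : C₀(X, ℂ)) (a : A), ZM.cmul (D.μ f) a ∈ S) (a : A) : a ∈ S := by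
  refine Submodule.topologicalClosure_minimal _ (Submodule.span_le.2 ?_) hS
    (D.nondegenerate ▸ Submodule.mem_top : a ∈ _)
  rintro _ ⟨f, b, rfl⟩
  exact h f b

variable (μM : C(StoneCech X, ℂ) →⋆ₐ[ℂ] ZM A)

theorem C0Algebra.H_le (z : StoneCech X) {S : Submodule ℂ 𝓜(ℂ, A)}
    (hS : IsClosed (S : Set 𝓜(ℂ, A)))
    (h : ∀ f : C(StoneCech X, ℂ), f z = 0 → ∀ m, (μM f : 𝓜(ℂ, A)) * m ∈ S) :
    (C0Algebra.H μM z).toSubmodule ≤ S := by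
  refine ClosedIdeal.le_of_eq_topologicalClosure rfl hS ?_
  rintro _ ⟨f, hf, m, rfl⟩
  exact h f hf m

theorem C0Algebra.mul_mem_H (z : StoneCech X) {f : C(StoneCech X, ℂ)} (hf : f z = 0)
    (m : 𝓜(ℂ, A)) : (μM f : 𝓜(ℂ, A)) * m ∈ (C0Algebra.H μM z).toSubmodule :=
  Submodule.le_topologicalClosure _ (Submodule.subset_span ⟨f, hf, m, rfl⟩)

end Generators

/-! ### Vectors killed in the limit by a family of seminorms. -/

section Seminorms

variable {E : Type*} [SeminormedAddCommGroup E] [NormedSpace ℂ E] {Y : Type*}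

/-- The vectors along which a family of seminorms tends to zero. -/
def tendstoZero (l : Filter Y) (p : Y → Seminorm ℂ E) : Submodule ℂ E where
  carrier := {b | Tendsto (fun i => p i b) l (𝓝 0)}
  zero_mem' := by simpa using tendsto_const_nhds
  add_mem' {a b} ha hb := by
    have h : Tendsto (fun i => p i a + p i b) l (𝓝 0) := by simpa using Tendsto.add ha hb
    exact squeeze_zero (fun i => apply_nonneg _ _) (fun i => map_add_le_add (p i) a b) h
  smul_mem' t b hb := by
    have h : Tendsto (fun i => ‖t‖ * p i b) l (𝓝 0) := by simpa using Tendsto.const_mul ‖t‖ hb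
    simpa only [mem_ofPred_eq, map_smul_eq_mul] using h

theorem mem_tendstoZero {l : Filter Y} {p : Y → Seminorm ℂ E} {b : E} :
    b ∈ tendstoZero l p ↔ ∀ ε > 0, ∀ᶠ i in l, p i b < ε := by
  refine ⟨fun h ε hε => h.eventually (gt_mem_nhds hε), fun h => ?_⟩
  refine tendsto_order.2 ⟨fun r hr => .of_forall fun i => hr.trans_le (apply_nonneg _ _), h⟩

/-- The bound `hp` makes the family equicontinuous, so a nearby element of the subspace controls `p
i b` uniformly in `i`. -/
theorem isClosed_tendstoZero (l : Filter Y) (p : Y → Seminorm ℂ E) (hp : ∀ i b, p i b ≤ ‖b‖) :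
    IsClosed (tendstoZero l p : Set E) := by
  refine isClosed_of_closure_subset fun b hb => mem_tendstoZero.2 fun ε hε => ?_
  obtain ⟨c, hc, hbc⟩ := Metric.mem_closure_iff.1 hb (ε / 2) (half_pos hε)
  filter_upwards [mem_tendstoZero.1 hc (ε / 2) (half_pos hε)] with i hi
  calc p i b = p i ((b - c) + c) := by rw [sub_add_cancel]
    _ ≤ p i (b - c) + p i c := map_add_le_add _ _ _
    _ < ε / 2 + ε / 2 := add_lt_add_of_le_of_lt
      ((hp i _).trans (by rw [← dist_eq_norm]; exact hbc.le)) hi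
    _ = ε := add_halves ε

end Seminorms

/-! ### Norm estimates for the action of `C(K)`. -/

section Action

variable {A : Type v} [NonUnitalCStarAlgebra A]

theorem ZM.norm_cmul_le (z : ZM A) (a : A) : ‖ZM.cmul z a‖ ≤ ‖(z : 𝓜(ℂ, A))‖ * ‖a‖ := by
  rw [← DoubleCentralizer.norm_fst]
  exact (z : 𝓜(ℂ, A)).fst.le_opNorm a

variable {K : Type w} [TopologicalSpace K] [CompactSpace K] (φ : C(K, ℂ) →⋆ₐ[ℂ] ZM A)

theorem norm_structureMap_le (f : C(K, ℂ)) : ‖(φ f : 𝓜(ℂ, A))‖ ≤ ‖f‖ :=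
  NonUnitalStarAlgHom.norm_apply_le ((ZM A).subtype.comp φ) f

theorem norm_cmul_structureMap_le (f : C(K, ℂ)) (a : A) : ‖ZM.cmul (φ f) a‖ ≤ ‖f‖ * ‖a‖ :=
  (ZM.norm_cmul_le _ _).trans (by gcongr; exact norm_structureMap_le φ f)

theorem cmul_structureMap_mul (f g : C(K, ℂ)) (a : A) :
    ZM.cmul (φ (f * g)) a = ZM.cmul (φ f) (ZM.cmul (φ g) a) := by
  rw [map_mul]; rfl

theorem cmul_structureMap_one (a : A) : ZM.cmul (φ 1) a = a := by
  rw [map_one]; rfl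

/-- A real-valued function regarded as a complex-valued one. -/
noncomputable def complexify (h : C(K, ℝ)) : C(K, ℂ) := ⟨fun x => (h x : ℂ), by fun_prop⟩

@[simp] theorem complexify_apply (h : C(K, ℝ)) (x : K) : complexify h x = (h x : ℂ) := rfl

theorem norm_complexify_le {h : C(K, ℝ)} (hh : ∀ x, h x ∈ Icc (0 : ℝ) 1) :
    ‖complexify h‖ ≤ 1 := by
  refine (ContinuousMap.norm_le _ zero_le_one).2 fun x => ?_
  simpa [abs_of_nonneg (hh x).1] using (hh x).2

end Action

/-! ### Upper semicontinuity of fibre norms. -/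

section UpperSemicontinuity

variable {B : Type v} [NonUnitalNormedRing B] [StarRing B] [CStarRing B] [NormedSpace ℂ B]
  [IsScalarTower ℂ B B] [SMulCommClass ℂ B B] [StarModule ℂ B]
  {K : Type w} [TopologicalSpace K] (μ : C(K, ℂ) →⋆ₐ[ℂ] ZM B)

theorem ckIdeal_proj_cmul (y : K) (f : C(K, ℂ)) (b : B) :
    (ckIdeal μ y).proj (ZM.cmul (μ f) b) = f y • (ckIdeal μ y).proj b := by
  rw [← ClosedIdeal.proj_smul, ClosedIdeal.proj_eq_proj_iff]
  have h : ZM.cmul (μ f) b - f y • b = ZM.cmul (μ (f - algebraMap ℂ _ (f y))) b := by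
    rw [map_sub, AlgHomClass.commutes]; rfl
  rw [h]
  exact cmul_mem_ckIdeal μ y (by simp) b

/-- Some `c` in the ideal at `y` has `‖b - c‖ < ε`. The fibre norms of `c` tend to zero at `y`,
because on a generator `f b'` they are at most `|f| ‖b'‖` with `f y = 0`. -/
theorem eventually_norm_ckIdeal_proj_lt {y : K} {b : B} {ε : ℝ} (h : ‖(ckIdeal μ y).proj b‖ < ε) :
    ∀ᶠ x in 𝓝 y, ‖(ckIdeal μ x).proj b‖ < ε := by
  obtain ⟨c, hc, hcb⟩ := ClosedIdeal.exists_mem_norm_sub_lt _ h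
  have hle : (ckIdeal μ y).toSubmodule ≤ tendstoZero (𝓝 y) fun x => (ckIdeal μ x).seminorm := by
    refine ckIdeal_le μ y (isClosed_tendstoZero _ _ fun x b => ClosedIdeal.norm_proj_le _ _)
      fun f hf b => ?_
    have h1 : Tendsto (fun x => ‖f x‖ * ‖b‖) (𝓝 y) (𝓝 0) := by
      have := (f.continuous.norm.tendsto y).mul_const ‖b‖
      simpa [hf] using this
    refine squeeze_zero (fun x => apply_nonneg _ _) (fun x => ?_) h1
    rw [ClosedIdeal.seminorm_apply, ckIdeal_proj_cmul, ← ClosedIdeal.proj_smul,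
      ClosedIdeal.norm_proj_smul]
    gcongr
    exact ClosedIdeal.norm_proj_le _ _
  filter_upwards [mem_tendstoZero.1 (hle hc) _ (sub_pos.2 hcb)] with x hx
  have h2 : ‖(ckIdeal μ x).proj b‖ ≤ ‖(ckIdeal μ x).proj (b - c)‖ + ‖(ckIdeal μ x).proj c‖ := by
    have := norm_add_le ((ckIdeal μ x).proj (b - c)) ((ckIdeal μ x).proj c)
    rwa [← ClosedIdeal.proj_add, sub_add_cancel] at this
  have h3 := (ckIdeal μ x).norm_proj_le (b - c)
  rw [ClosedIdeal.seminorm_apply] at hx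
  linarith

end UpperSemicontinuity

/-! ### The norm as the supremum of the fibre norms. -/

section Local

variable {A : Type v} [NonUnitalCStarAlgebra A] {K : Type w} [TopologicalSpace K] [CompactSpace K]
  (φ : C(K, ℂ) →⋆ₐ[ℂ] ZM A)

/-- The action of a function on `A`. -/
noncomputable def actionCLM (f : C(K, ℂ)) : A →L[ℂ] A := (φ f : 𝓜(ℂ, A)).fst

theorem complexify_mul (h k : C(K, ℝ)) : complexify (h * k) = complexify h * complexify k := by
  ext x; simp

/-- The functions `K → [0, 1]`. -/
abbrev UnitFun (K : Type w) [TopologicalSpace K] := {h : C(K, ℝ) // ∀ x, h x ∈ Icc (0 : ℝ) 1}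

/-- The square root of a function `K → [0, 1]`. -/
noncomputable def UnitFun.sqrt (h : UnitFun K) : UnitFun K :=
  ⟨⟨fun x => √(h.1 x), by fun_prop⟩, fun x => ⟨Real.sqrt_nonneg _, Real.sqrt_le_one.2 (h.2 x).2⟩⟩

theorem UnitFun.sqrt_mul_sqrt (h : UnitFun K) : h.sqrt.1 * h.sqrt.1 = h.1 := by
  ext x; exact Real.mul_self_sqrt (h.2 x).1

theorem UnitFun.support_sqrt (h : UnitFun K) :
    Function.support h.sqrt.1 = Function.support h.1 := by
  ext x
  simp only [UnitFun.sqrt, ContinuousMap.coe_mk, Function.mem_support, ne_eq,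
    Real.sqrt_eq_zero (h.2 x).1]

/-- The seminorm `a ↦ ‖h a‖`. -/
noncomputable def cutoffSeminorm (h : UnitFun K) : Seminorm ℂ A :=
  (normSeminorm ℂ A).comp (actionCLM φ (complexify h.1)).toLinearMap

theorem cutoffSeminorm_apply (h : UnitFun K) (a : A) :
    cutoffSeminorm φ h a = ‖ZM.cmul (φ (complexify h.1)) a‖ := rfl

theorem cutoffSeminorm_le (h : UnitFun K) (a : A) : cutoffSeminorm φ h a ≤ ‖a‖ := by
  refine (norm_cmul_structureMap_le φ _ a).trans ?_
  exact mul_le_of_le_one_left (norm_nonneg _) (norm_complexify_le h.2)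

/-- The filter on cut-off functions is that of supports shrinking to `y`. On a generator `f b` with
`f y = 0`, the product `h f` is uniformly small once the support of `h` lies where `f` is small. -/
theorem ckIdeal_le_tendstoZero (y : K) : (ckIdeal φ y).toSubmodule ≤
    tendstoZero (comap (fun h : UnitFun K => Function.support h.1) (𝓝 y).smallSets)
      (cutoffSeminorm φ) := by
  refine ckIdeal_le φ y (isClosed_tendstoZero _ _ (cutoffSeminorm_le φ)) fun f hf b => ?_
  refine mem_tendstoZero.2 fun ε hε => ?_
  have hδ : 0 < ε / (‖b‖ + 1) := by positivity
  have hU : {x | ‖f x‖ < ε / (‖b‖ + 1)} ∈ 𝓝 y :=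
    (f.continuous.norm.tendsto y).eventually (gt_mem_nhds (by simpa [hf] using hδ))
  filter_upwards [preimage_mem_comap (eventually_smallSets_subset.2 hU)] with h hh
  rw [cutoffSeminorm_apply, ← cmul_structureMap_mul]
  calc _ ≤ ‖complexify h.1 * f‖ * ‖b‖ := norm_cmul_structureMap_le φ _ b
    _ ≤ ε / (‖b‖ + 1) * ‖b‖ := by
      gcongr
      refine (ContinuousMap.norm_le _ hδ.le).2 fun x => ?_
      by_cases hx : h.1 x = 0
      · simpa [hx] using hδ.le
      · have h1 : ‖f x‖ < ε / (‖b‖ + 1) := hh hx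
        have h2 : ‖(h.1 x : ℂ)‖ ≤ 1 := by simpa [abs_of_nonneg (h.2 x).1] using (h.2 x).2
        simpa using mul_le_mul h2 h1.le (norm_nonneg _) zero_le_one
    _ < ε := by
      rw [div_mul_eq_mul_div, div_lt_iff₀ (by positivity)]
      exact mul_lt_mul_of_pos_left (lt_add_one _) hε

theorem exists_nhds_norm_cmul_le {a : A} {α : ℝ} {y : K} (h : ‖(ckIdeal φ y).proj a‖ < α) :
    ∃ U : Set K, IsOpen U ∧ y ∈ U ∧ ∀ h : UnitFun K, Function.support h.1 ⊆ U →
      ‖ZM.cmul (φ (complexify h.1)) a‖ ≤ α := by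
  obtain ⟨c, hc, hca⟩ := ClosedIdeal.exists_mem_norm_sub_lt _ h
  have hev := mem_tendstoZero.1 (ckIdeal_le_tendstoZero φ y hc) _ (sub_pos.2 hca)
  rw [eventually_comap, eventually_smallSets] at hev
  obtain ⟨s, hs, hsh⟩ := hev
  obtain ⟨U, hUs, hU, hyU⟩ := mem_nhds_iff.1 hs
  refine ⟨U, hU, hyU, fun h hh => ?_⟩
  have h1 := hsh _ (hh.trans hUs) h rfl
  have h2 := cutoffSeminorm_le φ h (a - c)
  have h3 := map_add_le_add (cutoffSeminorm φ h) (a - c) c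
  rw [sub_add_cancel, cutoffSeminorm_apply φ h a] at h3
  linarith

variable [T2Space K]

/-- Summing over the partition of unity loses a factor `n`. Since `h c² = (√h c)(√h c)`, the local
bound `α` for `c` becomes `α²` for `c²`. The lossy sum is thus taken only once, for the power `c ^ 2
^ k`, and the factor `n` disappears on extracting roots. Allowing every cut-off supported in `S i`,
and not just `p i`, keeps the hypothesis stable under square roots. -/
theorem norm_pow_le_of_cutoff {n : ℕ} {p : Fin n → UnitFun K} (hp : ∑ i, (p i).1 = 1)
    {S : Fin n → Set K} (hS : ∀ i, Function.support (p i).1 ⊆ S i) (k : ℕ) :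
    ∀ (c : A) (α : ℝ), IsSelfAdjoint c → (∀ i, ∀ h : UnitFun K, Function.support h.1 ⊆ S i →
      ‖ZM.cmul (φ (complexify h.1)) c‖ ≤ α) → ‖c‖ ^ 2 ^ k ≤ n * α ^ 2 ^ k := by
  induction k with
  | zero =>
    intro c α _ h
    have h1 : c = ∑ i, ZM.cmul (φ (complexify (p i).1)) c := by
      have h2 : (1 : C(K, ℂ)) = ∑ i, complexify (p i).1 := by
        ext x
        have := congrArg (fun f : C(K, ℝ) => ((f x : ℝ) : ℂ)) hp
        simpa using this.symm
      conv_lhs => rw [← cmul_structureMap_one φ c, h2, map_sum]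
      have h3 : ∀ s : Finset (Fin n), ZM.cmul (∑ i ∈ s, φ (complexify (p i).1)) c =
          ∑ i ∈ s, ZM.cmul (φ (complexify (p i).1)) c := by
        intro s
        induction s using Finset.cons_induction with
        | empty => rfl
        | cons i s hi ih => rw [Finset.sum_cons, Finset.sum_cons, ← ih]; rfl
      exact h3 _
    simp only [pow_zero, pow_one]
    calc ‖c‖ = ‖∑ i, ZM.cmul (φ (complexify (p i).1)) c‖ := congrArg _ h1
      _ ≤ ∑ i : Fin n, α := norm_sum_le_of_le _ fun i _ => h i _ (hS i)
      _ = n * α := by simp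
  | succ k ih =>
    intro c α hc h
    have h1 : ‖c * c‖ = ‖c‖ ^ 2 := by
      rw [sq, ← CStarRing.norm_star_mul_self, hc.star_eq]
    have h2 := ih (c * c) (α ^ 2) (by rw [IsSelfAdjoint, star_mul, hc.star_eq]) fun i h' hh' => by
      have h3 := h i h'.sqrt (by rwa [UnitFun.support_sqrt])
      rw [← UnitFun.sqrt_mul_sqrt, complexify_mul, cmul_structureMap_mul, ZM.cmul_mul,
        ← ZM.mul_cmul, sq]
      exact (norm_mul_le _ _).trans (mul_le_mul h3 h3 (norm_nonneg _) ((norm_nonneg _).trans h3))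
    rw [h1, ← pow_mul, ← pow_mul] at h2
    rwa [pow_succ']

theorem le_of_forall_pow_two_pow_le {r α C : ℝ} (hα : 0 ≤ α)
    (h : ∀ k : ℕ, r ^ 2 ^ k ≤ C * α ^ 2 ^ k) : r ≤ α := by
  by_contra! hr
  rcases hα.eq_or_lt with rfl | hα
  · have := h 0
    simp at this; linarith
  · have h1 : 1 < r / α := (one_lt_div hα).2 hr
    obtain ⟨k, hk⟩ := pow_unbounded_of_one_lt C h1
    have h2 : (r / α) ^ k ≤ (r / α) ^ 2 ^ k := pow_le_pow_right₀ h1.le Nat.lt_two_pow_self.le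
    have h3 : (r / α) ^ 2 ^ k ≤ C := by
      rw [div_pow, div_le_iff₀ (by positivity)]; exact h k
    linarith

/-- The norm of an element of a `C(K)`-algebra is the supremum of the norms in the fibres. -/
theorem norm_le_of_forall_norm_proj_lt {a : A} {α : ℝ} (hα : 0 ≤ α)
    (h : ∀ y, ‖(ckIdeal φ y).proj a‖ < α) : ‖a‖ ≤ α := by
  choose U hU hyU hUa using fun y => exists_nhds_norm_cmul_le φ (h y)
  obtain ⟨t, -, ht⟩ := isCompact_univ.elim_nhds_subcover U fun y _ => (hU y).mem_nhds (hyU y)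
  obtain ⟨p, hpS, hp1, hp, -⟩ := exists_continuous_sum_one_of_isOpen_isCompact
    (s := fun i => U (t.equivFin.symm i)) (fun i => hU _) isCompact_univ (fun x hx => by
      obtain ⟨y, hy, hxy⟩ := mem_iUnion₂.1 (ht hx)
      exact mem_iUnion.2 ⟨t.equivFin ⟨y, hy⟩, by simpa using hxy⟩)
  have hsum : ∑ i, (⟨p i, hp i⟩ : UnitFun K).1 = 1 := by
    ext x
    simpa using hp1 (mem_univ x)
  -- Squaring needs a self-adjoint element, hence `star a * a`; its local bounds come from `h (a* a)
  -- = (√h a)* (√h a)`.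
  have key : ‖star a * a‖ ≤ α ^ 2 := by
    refine le_of_forall_pow_two_pow_le (by positivity) fun k => norm_pow_le_of_cutoff φ
      (p := fun i => ⟨p i, hp i⟩) hsum (S := fun i => U (t.equivFin.symm i))
      (fun i => (subset_tsupport _).trans (hpS i)) k (star a * a) (α ^ 2)
      (IsSelfAdjoint.star_mul_self a) fun i h hh => ?_
    have h3 := hUa _ h.sqrt (by rwa [UnitFun.support_sqrt])
    have h4 : star (complexify h.sqrt.1) = complexify h.sqrt.1 := by
      ext x; simp
    have h5 : star (ZM.cmul (φ (complexify h.sqrt.1)) a) =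
        ZM.cmul (φ (complexify h.sqrt.1)) (star a) := by
      rw [ZM.star_cmul, ← map_star, h4]
    rw [← UnitFun.sqrt_mul_sqrt, complexify_mul, cmul_structureMap_mul, ← ZM.mul_cmul,
      ZM.cmul_mul, ← h5, CStarRing.norm_star_mul_self, sq]
    exact mul_le_mul h3 h3 (norm_nonneg _) hα
  rw [CStarRing.norm_star_mul_self, ← sq] at key
  exact (pow_le_pow_iff_left₀ (norm_nonneg _) hα two_ne_zero).1 key

end Local

/-! ### `A` as an algebra over the one-point compactification. -/

section OnePoint

variable {X : Type u} [TopologicalSpace X] [T2Space X]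

/-- A function vanishing at infinity as a function on the one-point compactification. -/
noncomputable def extendByZero (g : C₀(X, ℂ)) : C(OnePoint X, ℂ) where
  toFun p := p.elim 0 g
  continuous_toFun := by
    rw [OnePoint.continuous_iff]
    refine ⟨?_, g.continuous_toFun⟩
    rw [coclosedCompact_eq_cocompact]
    exact zero_at_infty g

@[simp] theorem extendByZero_coe (g : C₀(X, ℂ)) (x : X) : extendByZero g x = g x := rfl

@[simp] theorem extendByZero_infty (g : C₀(X, ℂ)) : extendByZero g OnePoint.infty = 0 := rfl

/-- The function `f - f(∞)` on `X`. -/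
noncomputable def vanishingPart (f : C(OnePoint X, ℂ)) : C₀(X, ℂ) where
  toFun x := f x - f OnePoint.infty
  continuous_toFun := (f.continuous.comp OnePoint.continuous_coe).sub continuous_const
  zero_at_infty' := by
    have h := ((f.continuous.tendsto _).comp (OnePoint.tendsto_coe_infty (X := X))).sub_const
      (f OnePoint.infty)
    rwa [sub_self, coclosedCompact_eq_cocompact] at h

@[simp] theorem vanishingPart_apply (f : C(OnePoint X, ℂ)) (x : X) :
    vanishingPart f x = f x - f OnePoint.infty := rfl

namespace C0Algebra

variable {A : Type v} [NonUnitalCStarAlgebra A] (D : C0Algebra X A)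

/-- The unital extension of the structure map to `C(X ∪ {∞})`. -/
noncomputable def onePointMap : C(OnePoint X, ℂ) →⋆ₐ[ℂ] ZM A where
  toFun f := algebraMap ℂ (ZM A) (f OnePoint.infty) + D.μ (vanishingPart f)
  map_one' := by
    have h : vanishingPart (1 : C(OnePoint X, ℂ)) = 0 := by ext x; simp
    simp [h]
  map_mul' f g := by
    have h : vanishingPart (f * g) = f OnePoint.infty • vanishingPart g +
        g OnePoint.infty • vanishingPart f + vanishingPart f * vanishingPart g := by
      ext x; simp; ring
    simp only [h, map_add, map_mul, map_smul, ContinuousMap.mul_apply, Algebra.algebraMap_eq_smul_one,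
      add_mul, mul_add, smul_mul_assoc, mul_smul_comm, one_mul, mul_one]
    rw [smul_add, smul_comm]
    abel
  map_zero' := by
    have h : vanishingPart (0 : C(OnePoint X, ℂ)) = 0 := by ext x; simp
    simp [h]
  map_add' f g := by
    have h : vanishingPart (f + g) = vanishingPart f + vanishingPart g := by ext x; simp; ring
    simp only [h, map_add, ContinuousMap.add_apply]
    abel
  commutes' r := by
    have h : vanishingPart (algebraMap ℂ C(OnePoint X, ℂ) r) = 0 := by ext x; simp
    simp [h]
  map_star' f := by
    have h : vanishingPart (star f) = star (vanishingPart f) := by ext x; simp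
    simp only [h, map_star, ContinuousMap.star_apply, star_add, algebraMap_star_comm]

theorem onePointMap_of_infty {f : C(OnePoint X, ℂ)} (hf : f OnePoint.infty = 0) :
    D.onePointMap f = D.μ (vanishingPart f) := by
  change algebraMap ℂ (ZM A) (f OnePoint.infty) + _ = _
  rw [hf, map_zero, zero_add]

theorem onePointMap_extendByZero (g : C₀(X, ℂ)) : D.onePointMap (extendByZero g) = D.μ g := by
  rw [onePointMap_of_infty _ rfl]
  congr 1
  ext x; simp

theorem isClosed_comap (S : Submodule ℂ A) (hS : IsClosed (S : Set A)) (T : A →L[ℂ] A) :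
    IsClosed (S.comap T.toLinearMap : Set A) := hS.preimage T.continuous

theorem ckIdeal_onePointMap (x : X) : ckIdeal D.onePointMap (x : OnePoint X) = D.J x := by
  have h : (ckIdeal D.onePointMap (x : OnePoint X)).toSubmodule = (D.J x).toSubmodule := by
    refine le_antisymm (ckIdeal_le _ _ (D.J x).closed fun f hf b => ?_)
      (D.J_le x (ClosedIdeal.closed _) fun f hf a => ?_)
    -- Here `f` need not vanish at `∞`, so `D.onePointMap f` need not come from `D.μ`. On the dense
    -- span of the elements `μ(g) a` it acts through `f g`, which vanishes at both `x` and `∞`.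
    · refine D.mem_of_nondegenerate (S := (D.J x).toSubmodule.comap
        (actionCLM D.onePointMap f).toLinearMap) (isClosed_comap _ (D.J x).closed _)
        (fun g a => ?_) b
      change ZM.cmul (D.onePointMap f) (ZM.cmul (D.μ g) a) ∈ (D.J x).toSubmodule
      rw [← onePointMap_extendByZero, ← cmul_structureMap_mul, onePointMap_of_infty _ (by simp)]
      exact D.cmul_mem_J x (by simp [hf]) a
    · rw [← onePointMap_extendByZero]
      exact cmul_mem_ckIdeal _ _ (by simpa using hf) a
  -- The remaining fields of a closed ideal are proofs, so equality of the submodules suffices.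
  generalize ckIdeal D.onePointMap (x : OnePoint X) = I at h
  generalize D.J x = J at h
  cases I; cases J
  congr

theorem norm_proj_onePointMap (x : X) (a : A) :
    ‖(ckIdeal D.onePointMap (x : OnePoint X)).proj a‖ = ‖(D.J x).proj a‖ := by
  rw [ckIdeal_onePointMap]

/-- Nondegeneracy: the span of the `μ(g) b` is dense, and each `g` extends by zero at `∞`. -/
theorem norm_proj_infty (a : A) : ‖(ckIdeal D.onePointMap OnePoint.infty).proj a‖ = 0 := by
  refine norm_eq_zero.2 ((ClosedIdeal.proj_eq_zero_iff _).2 ?_)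
  refine D.mem_of_nondegenerate (ClosedIdeal.closed _) (fun g b => ?_) a
  rw [← onePointMap_extendByZero]
  exact cmul_mem_ckIdeal _ _ (by simp) b

theorem proj_cmul_onePointMap (x : X) (f : C(OnePoint X, ℂ)) (a : A) :
    (D.J x).proj (ZM.cmul (D.onePointMap f) a) = f x • (D.J x).proj a := by
  rw [← ckIdeal_onePointMap]
  exact ckIdeal_proj_cmul _ _ _ _

theorem proj_cmul (x : X) (f : C₀(X, ℂ)) (a : A) :
    (D.J x).proj (ZM.cmul (D.μ f) a) = f x • (D.J x).proj a := by
  rw [← onePointMap_extendByZero, proj_cmul_onePointMap, extendByZero_coe]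

theorem norm_proj_eq_zero_of_notMem {x : X} (hx : x ∉ D.XA) (a : A) : ‖(D.J x).proj a‖ = 0 := by
  have h : (D.J x).toSubmodule = ⊤ := not_not.1 hx
  exact norm_eq_zero.2 ((ClosedIdeal.proj_eq_zero_iff _).2 (h ▸ Submodule.mem_top))

/-- The norm of a section is upper semicontinuous. -/
theorem eventually_norm_proj_lt {x : X} {a : A} {ε : ℝ} (h : ‖(D.J x).proj a‖ < ε) :
    ∀ᶠ y in 𝓝 x, ‖(D.J y).proj a‖ < ε := by
  rw [← ckIdeal_onePointMap] at h
  have := OnePoint.continuous_coe.continuousAt.eventually (eventually_norm_ckIdeal_proj_lt _ h)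
  simpa only [norm_proj_onePointMap] using this

/-- The norm of a section vanishes at infinity. -/
theorem isCompact_setOf_le_norm_proj (a : A) {ε : ℝ} (hε : 0 < ε) :
    IsCompact {x : X | ε ≤ ‖(D.J x).proj a‖} := by
  refine (OnePoint.isClosed_image_coe.1 ?_).2
  have h : ((↑) '' {x : X | ε ≤ ‖(D.J x).proj a‖} : Set (OnePoint X)) =
      {y | ‖(ckIdeal D.onePointMap y).proj a‖ < ε}ᶜ := by
    ext y
    induction y using OnePoint.rec with
    | infty => simp [norm_proj_infty, hε]
    | coe x => simp [norm_proj_onePointMap]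
  rw [h, isClosed_compl_iff, isOpen_iff_eventually]
  exact fun y hy => eventually_norm_ckIdeal_proj_lt _ hy

variable [LocallyCompactSpace X]

/-- The norm on `A` is the supremum of the norms in the fibres over `X_A`. -/
theorem norm_le_of_forall_norm_proj_le {a : A} {α : ℝ} (hα : 0 ≤ α)
    (h : ∀ x : D.XA, ‖(D.J x).proj a‖ ≤ α) : ‖a‖ ≤ α := by
  -- The local bound needs strict inequalities in the fibres, so `α` is enlarged to `β`; this also
  -- covers the zero fibres at `∞` and off `X_A`.
  refine le_of_forall_gt_imp_ge_of_dense fun β hβ => ?_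
  refine norm_le_of_forall_norm_proj_lt D.onePointMap (hα.trans hβ.le) fun y => ?_
  induction y using OnePoint.rec with
  | infty => rw [norm_proj_infty]; exact hα.trans_lt hβ
  | coe x =>
    rw [ckIdeal_onePointMap]
    by_cases hx : x ∈ D.XA
    · exact (h ⟨x, hx⟩).trans_lt hβ
    · rw [D.norm_proj_eq_zero_of_notMem hx]; exact hα.trans_lt hβ

theorem eq_of_forall_proj_eq {a b : A} (h : ∀ x : D.XA, (D.J x).proj a = (D.J x).proj b) :
    a = b := by
  rw [← sub_eq_zero, ← norm_le_zero_iff]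
  refine D.norm_le_of_forall_norm_proj_le le_rfl fun x => ?_
  rw [ClosedIdeal.proj_sub, h x, sub_self, norm_zero]

end C0Algebra

end OnePoint

/-! ### The actions of `C(βX_A)` and `C(βX)` on `A`. -/

section Extension

variable {X : Type u} [TopologicalSpace X]

namespace C0Algebra

variable {A : Type v} [NonUnitalCStarAlgebra A] (D : C0Algebra X A)

theorem fst_cmul (m : 𝓜(ℂ, A)) (z : ZM A) (a : A) :
    m.fst (ZM.cmul z a) = ZM.cmul z (m.fst a) :=
  congrArg (fun n : 𝓜(ℂ, A) => n.fst a) (ZM.comm z m)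

/-- Multipliers commute with `μ(f)`, hence preserve the generators of `J_x` and act on each fibre.
-/
theorem fst_mem_J (m : 𝓜(ℂ, A)) (x : X) {a : A} (ha : a ∈ (D.J x).toSubmodule) :
    m.fst a ∈ (D.J x).toSubmodule := by
  have h : (D.J x).toSubmodule ≤ (D.J x).toSubmodule.comap m.fst.toLinearMap := by
    refine D.J_le x (isClosed_comap _ (D.J x).closed _) fun f hf b => ?_
    change m.fst (ZM.cmul (D.μ f) b) ∈ (D.J x).toSubmodule
    rw [fst_cmul]
    exact D.cmul_mem_J x hf _
  exact h ha

theorem proj_fst_congr (m : 𝓜(ℂ, A)) (x : X) {a b : A} (h : (D.J x).proj a = (D.J x).proj b) :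
    (D.J x).proj (m.fst a) = (D.J x).proj (m.fst b) := by
  rw [ClosedIdeal.proj_eq_proj_iff] at h ⊢
  rw [← map_sub]
  exact D.fst_mem_J m x h

theorem norm_proj_fst_le (m : 𝓜(ℂ, A)) (x : X) (a : A) :
    ‖(D.J x).proj (m.fst a)‖ ≤ ‖m‖ * ‖(D.J x).proj a‖ := by
  rw [← DoubleCentralizer.norm_fst]
  exact (D.J x).norm_proj_map_le m.fst (fun c hc => D.fst_mem_J m x hc) a

variable [T2Space X] [LocallyCompactSpace X]

theorem exists_onePoint_extension (f : C(StoneCech D.XA, ℂ)) {C : Set X} (hC : IsCompact C)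
    (hCX : C ⊆ D.XA) : ∃ g : C(OnePoint X, ℂ), (∀ y, ‖g y‖ ≤ ‖f‖ + 1) ∧
      ∀ x : D.XA, (x : X) ∈ C → g (x : X) = f (stoneCechUnit x) := by
  -- The Tietze property of a closed ball requires a positive radius; adding `1` covers `f = 0`.
  have hR : 0 < ‖f‖ + 1 := by positivity
  have := isCompact_iff_compactSpace.1 hC
  have := Metric.instTietzeExtensionClosedBall.{u, 0} ℂ (0 : ℂ) hR
  have he : IsClosedEmbedding (fun x : C => ((x : X) : OnePoint X)) :=
    (OnePoint.continuous_coe.comp continuous_subtype_val).isClosedEmbedding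
      (OnePoint.coe_injective.comp Subtype.val_injective)
  have hk : Continuous fun x : C => f (stoneCechUnit (inclusion hCX x)) :=
    f.continuous.comp (continuous_stoneCechUnit.comp (continuous_inclusion hCX))
  obtain ⟨g, hg, hgf⟩ := ContinuousMap.exists_extension_forall_mem
    (t := Metric.closedBall (0 : ℂ) (‖f‖ + 1)) he ⟨_, hk⟩ fun x => by
      rw [mem_closedBall_zero_iff]
      exact (f.norm_coe_le_norm _).trans (le_add_of_nonneg_right zero_le_one)
  refine ⟨g, fun y => mem_closedBall_zero_iff.1 (hg y), fun x hx => ?_⟩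
  exact congrArg (fun k : C(C, ℂ) => k ⟨x, hx⟩) hgf

/-- The set where `‖a(x)‖ ≥ ε` is compact and contained in `X_A`. A Tietze extension `g` of `f` from
this set gives `b = g a`; elsewhere the error is at most `|g - f| ε`. -/
theorem exists_approx_smul (f : C(StoneCech D.XA, ℂ)) (a : A) {ε : ℝ} (hε : 0 < ε) :
    ∃ b : A, ∀ x : D.XA, ‖(D.J x).proj (b - f (stoneCechUnit x) • a)‖ ≤ 2 * (‖f‖ + 1) * ε := by
  obtain ⟨g, hg, hgf⟩ := D.exists_onePoint_extension f (D.isCompact_setOf_le_norm_proj a hε)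
    fun x hx => by
      by_contra h
      exact absurd (hx.trans_eq (D.norm_proj_eq_zero_of_notMem h a)) (not_le.2 hε)
  refine ⟨ZM.cmul (D.onePointMap g) a, fun x => ?_⟩
  rw [ClosedIdeal.proj_sub, proj_cmul_onePointMap, ← ClosedIdeal.proj_smul,
    ← ClosedIdeal.proj_sub, ← sub_smul, ClosedIdeal.norm_proj_smul]
  rcases le_or_gt ε ‖(D.J x).proj a‖ with h | h
  · rw [hgf x h, sub_self, norm_zero, zero_mul]
    positivity
  · gcongr
    calc _ ≤ ‖g (x : X)‖ + ‖f (stoneCechUnit x)‖ := norm_sub_le _ _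
      _ ≤ (‖f‖ + 1) + (‖f‖ + 1) := add_le_add (hg _)
        ((f.norm_coe_le_norm _).trans (le_add_of_nonneg_right zero_le_one))
      _ = _ := by ring

theorem exists_smul (f : C(StoneCech D.XA, ℂ)) (a : A) :
    ∃ b : A, ∀ x : D.XA, (D.J x).proj b = (D.J x).proj (f (stoneCechUnit x) • a) := by
  set R := 2 * (‖f‖ + 1)
  have hR : 0 < R := by positivity
  choose b hb using fun n : ℕ => D.exists_approx_smul f a (one_div_pos.2 (n.cast_add_one_pos (α := ℝ)))
  have hlim : Tendsto (fun n : ℕ => R * (1 / ((n : ℝ) + 1))) atTop (𝓝 0) := by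
    simpa using tendsto_one_div_add_atTop_nhds_zero_nat.const_mul R
  have hmono : ∀ {N n : ℕ}, N ≤ n → ∀ x : D.XA,
      ‖(D.J x).proj (b n - f (stoneCechUnit x) • a)‖ ≤ R * (1 / ((N : ℝ) + 1)) := fun h x =>
    (hb _ x).trans (by gcongr)
  -- Fibrewise estimates become norm estimates by the supremum formula.
  have hcauchy : CauchySeq b := by
    refine cauchySeq_of_le_tendsto_0 (fun n : ℕ => 2 * (R * (1 / ((n : ℝ) + 1))))
      (fun n m N hn hm => ?_) (by simpa using hlim.const_mul 2)
    rw [dist_eq_norm]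
    refine D.norm_le_of_forall_norm_proj_le (by positivity) fun x => ?_
    have h : b n - b m = (b n - f (stoneCechUnit x) • a) - (b m - f (stoneCechUnit x) • a) := by
      abel
    rw [h, ClosedIdeal.proj_sub]
    calc _ ≤ _ := norm_sub_le _ _
      _ ≤ _ := add_le_add (hmono hn x) (hmono hm x)
      _ = _ := by ring
  obtain ⟨c, hc⟩ := cauchySeq_tendsto_of_complete hcauchy
  refine ⟨c, fun x => ?_⟩
  rw [← sub_eq_zero, ← ClosedIdeal.proj_sub, ← norm_eq_zero]
  refine le_antisymm (ge_of_tendsto' (f := fun n : ℕ => ‖c - b n‖ + R * (1 / ((n : ℝ) + 1)))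
    (x := atTop) ?_ fun n => ?_) (norm_nonneg _)
  · have h := (tendsto_const_nhds (x := c)).sub hc
    simpa using h.norm.add hlim
  · have h : c - f (stoneCechUnit x) • a = (c - b n) + (b n - f (stoneCechUnit x) • a) := by abel
    rw [h, ClosedIdeal.proj_add]
    exact (norm_add_le _ _).trans (add_le_add (ClosedIdeal.norm_proj_le _ _) (hb n x))

/-- The element of `A` with the fibres `f(x) a(x)`. -/
noncomputable def sectionSMul (f : C(StoneCech D.XA, ℂ)) (a : A) : A := (D.exists_smul f a).choose

theorem proj_sectionSMul (f : C(StoneCech D.XA, ℂ)) (a : A) (x : D.XA) :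
    (D.J x).proj (D.sectionSMul f a) = (D.J x).proj (f (stoneCechUnit x) • a) :=
  (D.exists_smul f a).choose_spec x

/-- The operator `a ↦ f a` on `A`. -/
noncomputable def sectionSMulCLM (f : C(StoneCech D.XA, ℂ)) : A →L[ℂ] A :=
  LinearMap.mkContinuous
    { toFun := D.sectionSMul f
      map_add' := fun a b => D.eq_of_forall_proj_eq fun x => by
        simp only [proj_sectionSMul, ClosedIdeal.proj_add, smul_add]
      map_smul' := fun t a => D.eq_of_forall_proj_eq fun x => by
        rw [RingHom.id_apply, ClosedIdeal.proj_smul, proj_sectionSMul, proj_sectionSMul,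
          smul_comm, ClosedIdeal.proj_smul] }
    ‖f‖ fun a => D.norm_le_of_forall_norm_proj_le (by positivity) fun x => by
      change ‖(D.J x).proj (D.sectionSMul f a)‖ ≤ _
      rw [proj_sectionSMul, ClosedIdeal.norm_proj_smul]
      exact mul_le_mul (f.norm_coe_le_norm _) (ClosedIdeal.norm_proj_le _ _) (norm_nonneg _)
        (norm_nonneg _)

theorem sectionSMulCLM_apply (f : C(StoneCech D.XA, ℂ)) (a : A) :
    D.sectionSMulCLM f a = D.sectionSMul f a := rfl

/-- The multiplication by `f`, as a central multiplier. -/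
noncomputable def sectionMultiplier (f : C(StoneCech D.XA, ℂ)) : ZM A :=
  ⟨⟨(D.sectionSMulCLM f, D.sectionSMulCLM f), fun a b => D.eq_of_forall_proj_eq fun x => by
      simp only [sectionSMulCLM_apply]
      rw [ClosedIdeal.proj_mul, proj_sectionSMul, ← ClosedIdeal.proj_mul, ClosedIdeal.proj_mul _ a,
        proj_sectionSMul, ← ClosedIdeal.proj_mul, smul_mul_assoc, mul_smul_comm]⟩,
    -- Centrality: `m` acts linearly on each fibre, where the multiplication by `f` is a scalar.
    Subalgebra.mem_center_iff.2 fun m => doubleCentralizer_ext_fst fun a =>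
      D.eq_of_forall_proj_eq fun x => by
        change (D.J x).proj (m.fst (D.sectionSMul f a)) = (D.J x).proj (D.sectionSMul f (m.fst a))
        rw [D.proj_fst_congr m x (D.proj_sectionSMul f a x), proj_sectionSMul, map_smul]⟩

theorem proj_cmul_sectionMultiplier (f : C(StoneCech D.XA, ℂ)) (a : A) (x : D.XA) :
    (D.J x).proj (ZM.cmul (D.sectionMultiplier f) a) =
      (D.J x).proj (f (stoneCechUnit x) • a) := D.proj_sectionSMul f a x

theorem zm_ext_proj {z z' : ZM A} (h : ∀ (x : D.XA) (a : A),
    (D.J x).proj (ZM.cmul z a) = (D.J x).proj (ZM.cmul z' a)) : z = z' :=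
  ZM.ext_cmul fun a => D.eq_of_forall_proj_eq fun x => h x a

/-- The action of `C(βX_A)` on `A`. -/
noncomputable def betaMap : C(StoneCech D.XA, ℂ) →⋆ₐ[ℂ] ZM A where
  toFun := D.sectionMultiplier
  map_one' := D.zm_ext_proj fun x a => by
    rw [proj_cmul_sectionMultiplier, ContinuousMap.one_apply, one_smul]; rfl
  map_zero' := D.zm_ext_proj fun x a => by
    rw [proj_cmul_sectionMultiplier, ContinuousMap.zero_apply, zero_smul]; rfl
  map_add' f g := D.zm_ext_proj fun x a => by
    rw [proj_cmul_sectionMultiplier, ContinuousMap.add_apply, add_smul]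
    change _ = (D.J x).proj (ZM.cmul (D.sectionMultiplier f) a + ZM.cmul (D.sectionMultiplier g) a)
    rw [ClosedIdeal.proj_add, ClosedIdeal.proj_add, proj_cmul_sectionMultiplier,
      proj_cmul_sectionMultiplier]
  map_mul' f g := D.zm_ext_proj fun x a => by
    rw [proj_cmul_sectionMultiplier, ContinuousMap.mul_apply, mul_smul, ClosedIdeal.proj_smul,
      ClosedIdeal.proj_smul]
    change _ = (D.J x).proj (ZM.cmul (D.sectionMultiplier f) (ZM.cmul (D.sectionMultiplier g) a))
    rw [proj_cmul_sectionMultiplier, ClosedIdeal.proj_smul, proj_cmul_sectionMultiplier,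
      ClosedIdeal.proj_smul]
  commutes' r := D.zm_ext_proj fun x a => by
    rw [proj_cmul_sectionMultiplier]; rfl
  map_star' f := D.zm_ext_proj fun x a => by
    have h : ZM.cmul (star (D.sectionMultiplier f)) a =
        star (ZM.cmul (D.sectionMultiplier f) (star a)) := by
      rw [ZM.star_cmul, star_star]
    rw [h, ClosedIdeal.proj_star, proj_cmul_sectionMultiplier, proj_cmul_sectionMultiplier,
      ← ClosedIdeal.proj_star, star_smul, star_star]
    rfl

theorem proj_cmul_betaMap (f : C(StoneCech D.XA, ℂ)) (a : A) (x : D.XA) :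
    (D.J x).proj (ZM.cmul (D.betaMap f) a) = f (stoneCechUnit x) • (D.J x).proj a :=
  D.proj_sectionSMul f a x

theorem isBaseChange_betaMap : D.IsBaseChange stoneCechUnit D.betaMap := D.proj_cmul_betaMap

theorem eq_betaMap {ν : C(StoneCech D.XA, ℂ) →⋆ₐ[ℂ] ZM A}
    (hν : D.IsBaseChange stoneCechUnit ν) : ν = D.betaMap :=
  StarAlgHom.ext fun f => D.zm_ext_proj fun x a => by rw [hν, proj_cmul_betaMap]

theorem isBaseChange_restrict {K : Type w} [TopologicalSpace K] [CompactSpace K] [T2Space K]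
    {ι : D.XA → K} (hι : Continuous ι) :
    D.IsBaseChange ι (D.betaMap.comp (D.restrictToBeta hι)) := fun f a x => by
  refine (D.proj_cmul_betaMap _ a x).trans ?_
  congr 1
  exact congrArg f (stoneCechExtend_stoneCechUnit hι x)

theorem continuous_unit_coe : Continuous fun x : D.XA => stoneCechUnit (x : X) :=
  continuous_stoneCechUnit.comp continuous_subtype_val

/-- The extension of the structure map of `A` to `C(βX)`. -/
noncomputable def multiplierMap : C(StoneCech X, ℂ) →⋆ₐ[ℂ] ZM A :=
  D.betaMap.comp (D.restrictToBeta D.continuous_unit_coe)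

theorem proj_cmul_multiplierMap (f : C(StoneCech X, ℂ)) (a : A) (x : D.XA) :
    (D.J x).proj (ZM.cmul (D.multiplierMap f) a) = f (stoneCechUnit (x : X)) • (D.J x).proj a :=
  D.isBaseChange_restrict D.continuous_unit_coe f a x

theorem extends_multiplierMap : D.Extends D.multiplierMap := fun f g h =>
  D.zm_ext_proj fun x a => by rw [proj_cmul_multiplierMap, proj_cmul, h]

/-- A bounded function on `X` extends to `βX`. -/
theorem exists_stoneCech_extension (g : C₀(X, ℂ)) :
    ∃ f : C(StoneCech X, ℂ), ∀ x, f (stoneCechUnit x) = g x := by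
  set R := ‖g.toBCF‖
  have hg : ∀ x, g x ∈ Metric.closedBall (0 : ℂ) R := fun x =>
    mem_closedBall_zero_iff.2 (g.toBCF.norm_coe_le_norm x)
  have : CompactSpace (Metric.closedBall (0 : ℂ) R) :=
    isCompact_iff_compactSpace.1 (isCompact_closedBall 0 R)
  have hc : Continuous fun x => (⟨g x, hg x⟩ : Metric.closedBall (0 : ℂ) R) :=
    g.continuous_toFun.subtype_mk hg
  refine ⟨⟨fun y => (stoneCechExtend hc y).1, continuous_subtype_val.comp
    (continuous_stoneCechExtend hc)⟩, fun x => ?_⟩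
  exact congrArg Subtype.val (stoneCechExtend_stoneCechUnit hc x)

/-- For `g ∈ C₀(X)` the product `f g` is again in `C₀(X)`, so `μM(f) μ(g) b = μ(f g) b` is forced,
and the elements `μ(g) b` span a dense subspace. Below, `k` extends `g` to `βX` and `l` is `f g`. -/
theorem eq_multiplierMap {μM : C(StoneCech X, ℂ) →⋆ₐ[ℂ] ZM A} (h : D.Extends μM) :
    μM = D.multiplierMap := by
  refine StarAlgHom.ext fun f => ZM.ext_cmul fun a => ?_
  have hcl : IsClosed (((μM f : 𝓜(ℂ, A)).fst - (D.multiplierMap f : 𝓜(ℂ, A)).fst).ker :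
      Set A) := ContinuousLinearMap.isClosed_ker _
  refine sub_eq_zero.1 (D.mem_of_nondegenerate hcl (fun g b => ?_) a)
  obtain ⟨k, hk⟩ := exists_stoneCech_extension g
  obtain ⟨l, hl⟩ : ∃ l : C₀(X, ℂ), ∀ x, (f * k) (stoneCechUnit x) = l x := by
    refine ⟨⟨⟨fun x => (f * k) (stoneCechUnit x),
      (f * k).continuous.comp continuous_stoneCechUnit⟩, ?_⟩, fun x => rfl⟩
    have h0 : Tendsto (fun x => ‖f‖ * ‖g x‖) (cocompact X) (𝓝 0) := by
      simpa using (zero_at_infty g).norm.const_mul ‖f‖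
    refine squeeze_zero_norm (fun x => ?_) h0
    change ‖f (stoneCechUnit x) * k (stoneCechUnit x)‖ ≤ _
    rw [norm_mul, hk]
    gcongr
    exact f.norm_coe_le_norm _
  have key : ∀ {μ' : C(StoneCech X, ℂ) →⋆ₐ[ℂ] ZM A}, D.Extends μ' →
      ZM.cmul (μ' f) (ZM.cmul (D.μ g) b) = ZM.cmul (D.μ l) b := fun {μ'} hμ' => by
    rw [← hμ' k g hk, ← cmul_structureMap_mul, hμ' _ l hl]
  exact sub_eq_zero.2 ((key h).trans (key D.extends_multiplierMap).symm)

end C0Algebra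

end Extension

/-! ### Products of multipliers with elements of `A`. -/

section Multipliers

variable {A : Type v} [NonUnitalCStarAlgebra A]

theorem norm_coe_multiplier (a : A) : ‖(a : 𝓜(ℂ, A))‖ = ‖a‖ := by
  rw [← DoubleCentralizer.norm_fst, DoubleCentralizer.coe_fst, ContinuousLinearMap.opNorm_mul_apply]

theorem coe_multiplier_sub (a b : A) : ((a - b : A) : 𝓜(ℂ, A)) = a - b :=
  map_sub (DoubleCentralizer.coeHom (𝕜 := ℂ) (A := A)) a b

theorem fst_mul (m : 𝓜(ℂ, A)) (a b : A) : m.fst (a * b) = m.fst a * b := by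
  rw [← sub_eq_zero, ← CStarRing.star_mul_self_eq_zero_iff]
  have h : ∀ d, d * (m.fst (a * b) - m.fst a * b) = 0 := fun d => by
    rw [mul_sub, ← mul_assoc, ← m.central, ← m.central, mul_assoc, sub_self]
  exact h _

theorem mul_coe_multiplier (m : 𝓜(ℂ, A)) (a : A) : m * a = (m.fst a : A) :=
  doubleCentralizer_ext_fst fun b => fst_mul m a b

theorem coe_multiplier_mul (a : A) (m : 𝓜(ℂ, A)) : a * m = (m.snd a : A) :=
  doubleCentralizer_ext_fst fun b => (m.central a b).symm

end Multipliers

/-! ### The local description of `H_x` and the closedness of `A^β`. -/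

namespace C0Algebra

variable {X : Type u} [TopologicalSpace X] {A : Type v} [NonUnitalCStarAlgebra A]
  (D : C0Algebra X A)

/-- The evaluation `m ↦ m a` of multipliers at `a`. -/
noncomputable def evalLinearMap (a : A) : 𝓜(ℂ, A) →ₗ[ℂ] A where
  toFun m := m.fst a
  map_add' _ _ := rfl
  map_smul' _ _ := rfl

/-- The seminorm `m ↦ ‖(m a)(y)‖` on `M(A)`. -/
noncomputable def evalSeminorm (i : D.XA × Metric.closedBall (0 : A) 1) :
    Seminorm ℂ 𝓜(ℂ, A) :=
  (D.J i.1).seminorm.comp (evalLinearMap (i.2 : A))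

theorem evalSeminorm_apply (i : D.XA × Metric.closedBall (0 : A) 1) (m : 𝓜(ℂ, A)) :
    D.evalSeminorm i m = ‖(D.J i.1).proj (m.fst i.2)‖ := rfl

theorem evalSeminorm_le (i : D.XA × Metric.closedBall (0 : A) 1) (m : 𝓜(ℂ, A)) :
    D.evalSeminorm i m ≤ ‖m‖ := by
  refine (D.norm_proj_fst_le m _ _).trans (mul_le_of_le_one_right (norm_nonneg _) ?_)
  exact (ClosedIdeal.norm_proj_le _ _).trans (mem_closedBall_zero_iff.1 i.2.2)

/-- The multipliers of `A` whose norm over small neighbourhoods of `x` tends to zero. -/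
noncomputable def vanishingAt (x : D.XA) : Submodule ℂ 𝓜(ℂ, A) :=
  tendstoZero (comap Prod.fst (𝓝 x)) D.evalSeminorm

theorem isClosed_vanishingAt (x : D.XA) : IsClosed (D.vanishingAt x : Set 𝓜(ℂ, A)) :=
  isClosed_tendstoZero _ _ D.evalSeminorm_le

variable {D} {K : Type w} [TopologicalSpace K] {ι : D.XA → K} {μK : C(K, ℂ) →⋆ₐ[ℂ] ZM A}

/-- Over `y` the product is bounded by `|f(ι y)| ‖m‖`, uniformly on the unit ball of `A`. -/
theorem mul_mem_vanishingAt (hμ : D.IsBaseChange ι μK) (hι : Continuous ι) {x : D.XA}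
    {f : C(K, ℂ)} (hf : f (ι x) = 0) (m : 𝓜(ℂ, A)) :
    (μK f : 𝓜(ℂ, A)) * m ∈ D.vanishingAt x := by
  have h1 : Tendsto (fun i : D.XA × Metric.closedBall (0 : A) 1 => ‖f (ι i.1)‖ * ‖m‖)
      (comap Prod.fst (𝓝 x)) (𝓝 0) := by
    have h := (((f.continuous.comp hι).norm.tendsto x).mul_const ‖m‖).comp
      (tendsto_comap (f := (Prod.fst : D.XA × Metric.closedBall (0 : A) 1 → D.XA)))
    simpa [hf, Function.comp_def] using h
  refine squeeze_zero (fun i => apply_nonneg _ _) (fun i => ?_) h1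
  change ‖(D.J i.1).proj (ZM.cmul (μK f) (m.fst i.2))‖ ≤ _
  rw [hμ, ← ClosedIdeal.proj_smul, ClosedIdeal.norm_proj_smul]
  gcongr
  exact D.evalSeminorm_le i m

variable [CompactSpace K] [T2Space K] [T2Space X] [LocallyCompactSpace X]

/-- As `ι` is inducing, `m` is small over the preimage of an open `V ∋ ι x` in `K`. A Urysohn
function vanishing off `V` kills the other fibres, and the supremum formula turns the fibre bounds
into a norm bound. -/
theorem exists_norm_mul_le (hμ : D.IsBaseChange ι μK) (hι : IsInducing ι) {x : D.XA}
    {m : 𝓜(ℂ, A)} (hm : m ∈ D.vanishingAt x) {ε : ℝ} (hε : 0 < ε) :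
    ∃ k : C(K, ℂ), k (ι x) = 1 ∧ ‖k‖ ≤ 1 ∧ ‖(μK k : 𝓜(ℂ, A)) * m‖ ≤ ε := by
  have hev := mem_tendstoZero.1 hm ε hε
  rw [eventually_comap, hι.nhds_eq_comap, eventually_comap] at hev
  obtain ⟨V, hV, hVo, hxV⟩ := eventually_nhds_iff.1 hev
  obtain ⟨h, h0, h1, h01⟩ := exists_continuous_zero_one_of_isClosed hVo.isClosed_compl
    (isClosed_singleton (x := ι x)) (disjoint_singleton_right.2 fun hx => hx hxV)
  refine ⟨complexify h, by simp [h1 rfl], norm_complexify_le h01, ?_⟩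
  rw [← DoubleCentralizer.norm_fst]
  refine ContinuousLinearMap.opNorm_le_of_unit_norm hε.le fun a ha => ?_
  refine D.norm_le_of_forall_norm_proj_le hε.le fun y => ?_
  change ‖(D.J y).proj (ZM.cmul (μK (complexify h)) (m.fst a))‖ ≤ ε
  rw [hμ, ← ClosedIdeal.proj_smul, ClosedIdeal.norm_proj_smul]
  by_cases hy : ι y ∈ V
  · have h2 := hV _ hy y rfl (y, ⟨a, mem_closedBall_zero_iff.2 ha.le⟩) rfl
    rw [evalSeminorm_apply] at h2
    have h3 : ‖complexify h (ι y)‖ ≤ 1 :=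
      ((complexify h).norm_coe_le_norm _).trans (norm_complexify_le h01)
    exact (mul_le_of_le_one_left (norm_nonneg _) h3).trans h2.le
  · rw [complexify_apply, h0 hy]
    simpa using hε.le

/-- An element vanishing at `x` is a limit of products with functions vanishing at `x`. -/
theorem exists_norm_sub_mul_le (hμ : D.IsBaseChange ι μK) (hι : IsInducing ι) {x : D.XA}
    {m : 𝓜(ℂ, A)} (hm : m ∈ D.vanishingAt x) {ε : ℝ} (hε : 0 < ε) :
    ∃ f : C(K, ℂ), f (ι x) = 0 ∧ ‖m - (μK f : 𝓜(ℂ, A)) * m‖ ≤ ε := by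
  obtain ⟨k, hk, -, hkm⟩ := exists_norm_mul_le hμ hι hm hε
  refine ⟨1 - k, by simp [hk], ?_⟩
  have h : m - (μK (1 - k) : 𝓜(ℂ, A)) * m = (μK k : 𝓜(ℂ, A)) * m := by
    have h1 : (μK (1 - k) : 𝓜(ℂ, A)) = 1 - (μK k : 𝓜(ℂ, A)) := by
      rw [map_sub, map_one]; rfl
    rw [h1, sub_mul, one_mul, sub_sub_cancel]
  rwa [h]

/-- Multiplying by a contractive cut-off `k` with `k(ι x) = 1` leaves `a(x)` unchanged, does not
increase `‖a - m‖`, and makes `k m` negligible. This is the lower half of the isometry of `A_x →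
M(A)/H_x`. -/
theorem norm_proj_le_norm_sub (hμ : D.IsBaseChange ι μK) (hι : IsInducing ι) {x : D.XA}
    {m : 𝓜(ℂ, A)} (hm : m ∈ D.vanishingAt x) (a : A) :
    ‖(D.J x).proj a‖ ≤ ‖(a : 𝓜(ℂ, A)) - m‖ := by
  refine le_of_forall_pos_le_add fun ε hε => ?_
  obtain ⟨k, hkx, hk, hkm⟩ := exists_norm_mul_le hμ hι hm hε
  have h1 : (D.J x).proj a = (D.J x).proj (ZM.cmul (μK k) a) := by
    rw [hμ, hkx, ← ClosedIdeal.proj_smul, one_smul]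
  have h2 : ((ZM.cmul (μK k) a : A) : 𝓜(ℂ, A)) =
      (μK k : 𝓜(ℂ, A)) * (a - m) + (μK k : 𝓜(ℂ, A)) * m := by
    rw [← mul_add, sub_add_cancel, mul_coe_multiplier]; rfl
  calc _ ≤ ‖ZM.cmul (μK k) a‖ := h1 ▸ ClosedIdeal.norm_proj_le _ _
    _ = ‖(μK k : 𝓜(ℂ, A)) * (a - m) + (μK k : 𝓜(ℂ, A)) * m‖ := by
      rw [← norm_coe_multiplier, h2]
    _ ≤ ‖(μK k : 𝓜(ℂ, A))‖ * ‖(a : 𝓜(ℂ, A)) - m‖ + ε :=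
      (norm_add_le _ _).trans (add_le_add (norm_mul_le _ _) hkm)
    _ ≤ _ := by
      gcongr
      exact mul_le_of_le_one_left (norm_nonneg _) ((norm_structureMap_le μK k).trans hk)

variable (D)

instance completelyRegularSpace_of_locallyCompactSpace : CompletelyRegularSpace X :=
  OnePoint.isOpenEmbedding_coe.isInducing.completelyRegularSpace

theorem isInducing_unit_coe : IsInducing fun x : D.XA => stoneCechUnit (x : X) :=
  isInducing_stoneCechUnit.comp IsInducing.subtypeVal

theorem isBaseChange_multiplierMap :
    D.IsBaseChange (fun x : D.XA => stoneCechUnit (x : X)) D.multiplierMap :=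
  D.isBaseChange_restrict D.continuous_unit_coe

theorem H_eq_vanishingAt (x : D.XA) :
    (H D.multiplierMap (stoneCechUnit (x : X))).toSubmodule = D.vanishingAt x := by
  refine le_antisymm (H_le _ _ (D.isClosed_vanishingAt x) fun f hf m =>
    mul_mem_vanishingAt D.isBaseChange_multiplierMap D.continuous_unit_coe hf m) fun m hm => ?_
  refine (ClosedIdeal.closed _).closure_subset (Metric.mem_closure_iff.2 fun ε hε => ?_)
  obtain ⟨f, hf, hfm⟩ := exists_norm_sub_mul_le D.isBaseChange_multiplierMap
    D.isInducing_unit_coe hm (half_pos hε)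
  refine ⟨_, mul_mem_H _ _ hf m, ?_⟩
  rw [dist_eq_norm]
  linarith

/-- This is `A ∩ H_x = J_x`. If `a(x) = 0`, upper semicontinuity makes `‖a(y)‖` small near `x`, and
`‖(a b)(y)‖ ≤ ‖a(y)‖ ‖b‖` makes this uniform in the unit ball. -/
theorem coe_mem_vanishingAt_iff {x : D.XA} {a : A} :
    (a : 𝓜(ℂ, A)) ∈ D.vanishingAt x ↔ a ∈ (D.J x).toSubmodule := by
  refine ⟨fun h => ?_, fun h => mem_tendstoZero.2 fun ε hε => ?_⟩
  · have := norm_proj_le_norm_sub D.isBaseChange_multiplierMap D.isInducing_unit_coe h a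
    rw [sub_self, norm_zero] at this
    exact (ClosedIdeal.proj_eq_zero_iff _).1 (norm_le_zero_iff.1 this)
  · have h0 : ‖(D.J x).proj a‖ < ε := by
      rwa [(ClosedIdeal.proj_eq_zero_iff _).2 h, norm_zero]
    have hev := continuous_subtype_val.continuousAt.eventually (D.eventually_norm_proj_lt h0)
    filter_upwards [tendsto_comap.eventually hev] with i hi
    refine lt_of_le_of_lt ((D.J i.1).norm_proj_mul_le a i.2) (lt_of_le_of_lt ?_ hi)
    exact mul_le_of_le_one_right (norm_nonneg _) (mem_closedBall_zero_iff.1 i.2.2)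

theorem mem_beta_iff {m : 𝓜(ℂ, A)} : m ∈ D.beta D.multiplierMap ↔
    ∀ x : D.XA, ∃ a : A, m - a ∈ D.vanishingAt x := by
  refine ⟨fun h x => ?_, fun h x hx => ?_⟩
  · obtain ⟨a, k, hk, rfl⟩ := h x x.2
    refine ⟨a, ?_⟩
    rw [add_sub_cancel_left, ← H_eq_vanishingAt]
    exact hk
  · obtain ⟨a, ha⟩ := h ⟨x, hx⟩
    rw [← H_eq_vanishingAt] at ha
    exact ⟨a, _, ha, (add_sub_cancel _ _).symm⟩

theorem norm_proj_H_coe_le (x : D.XA) (a : A) :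
    ‖(H D.multiplierMap (stoneCechUnit (x : X))).proj (a : 𝓜(ℂ, A))‖ ≤ ‖(D.J x).proj a‖ := by
  refine le_of_forall_pos_le_add fun ε hε => ?_
  obtain ⟨c, hc, hca⟩ := (D.J x).exists_mem_norm_sub_lt (lt_add_of_pos_right _ hε)
  have h := (H D.multiplierMap (stoneCechUnit (x : X))).norm_proj_le_of_mem (a : 𝓜(ℂ, A))
    (c := c) (by rw [H_eq_vanishingAt]; exact D.coe_mem_vanishingAt_iff.2 hc)
  rw [← coe_multiplier_sub, norm_coe_multiplier] at h
  exact h.trans hca.le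

instance ClosedIdeal.Quot.completeSpace (I : ClosedIdeal A) : CompleteSpace I.Quot :=
  inferInstanceAs (CompleteSpace (A ⧸ I.toSubmodule))

/-- If `m i` converges and `m i - a i` vanishes at `x`, the isometry makes `a i (x)` Cauchy in the
complete fibre `A_x`. A lift `b` of its limit represents the limit multiplier modulo `H_x`. -/
theorem isClosed_add_vanishingAt (x : D.XA) :
    IsClosed {m : 𝓜(ℂ, A) | ∃ a : A, m - a ∈ D.vanishingAt x} := by
  refine IsSeqClosed.isClosed fun m n hm hn => ?_
  choose a ha using hm
  have hdist : ∀ i j, dist ((D.J x).proj (a i)) ((D.J x).proj (a j)) ≤ dist (m i) (m j) :=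
    fun i j => by
      -- The subtracted element is `(m j - a j) - (m i - a i)`, so that the difference is exactly `m
      -- i - m j`.
      have h := norm_proj_le_norm_sub D.isBaseChange_multiplierMap D.isInducing_unit_coe
        (Submodule.sub_mem _ (ha j) (ha i)) (a i - a j)
      rw [dist_eq_norm, dist_eq_norm, ← ClosedIdeal.proj_sub]
      refine h.trans_eq (congrArg _ ?_)
      rw [coe_multiplier_sub]
      abel
  have hcauchy : CauchySeq fun i => (D.J x).proj (a i) := by
    rw [Metric.cauchySeq_iff]
    intro ε hε
    obtain ⟨N, hN⟩ := Metric.cauchySeq_iff.1 hn.cauchySeq ε hε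
    exact ⟨N, fun i hi j hj => (hdist i j).trans_lt (hN i hi j hj)⟩
  obtain ⟨q, hq⟩ := cauchySeq_tendsto_of_complete hcauchy
  obtain ⟨b, rfl⟩ := (D.J x).proj_surjective q
  refine ⟨b, ?_⟩
  rw [← H_eq_vanishingAt, ← ClosedIdeal.proj_eq_zero_iff, ← norm_eq_zero]
  refine le_antisymm (ge_of_tendsto' (f := fun i => ‖n - m i‖ + ‖(D.J x).proj (a i - b)‖)
    (x := atTop) ?_ fun i => ?_) (norm_nonneg _)
  · have h1 := ((tendsto_const_nhds (x := n)).sub hn).norm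
    have h2 := (hq.sub (tendsto_const_nhds (x := (D.J x).proj b))).norm
    simpa [ClosedIdeal.proj_sub] using h1.add h2
  · set I := H D.multiplierMap (stoneCechUnit (x : X))
    have h : n - (b : 𝓜(ℂ, A)) = (n - m i) + ((m i - a i) + ((a i - b : A) : 𝓜(ℂ, A))) := by
      rw [coe_multiplier_sub]; abel
    have h0 : I.proj (m i - a i) = 0 :=
      I.proj_eq_zero_iff.2 (by rw [H_eq_vanishingAt]; exact ha i)
    rw [h, ClosedIdeal.proj_add, ClosedIdeal.proj_add, h0, zero_add]
    exact (norm_add_le _ _).trans (add_le_add (I.norm_proj_le _) (D.norm_proj_H_coe_le x _))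

theorem isClosed_beta : IsClosed (D.beta D.multiplierMap : Set 𝓜(ℂ, A)) := by
  have h : (D.beta D.multiplierMap : Set 𝓜(ℂ, A)) =
      ⋂ x : D.XA, {m : 𝓜(ℂ, A) | ∃ a : A, m - a ∈ D.vanishingAt x} := by
    ext m
    simp only [mem_iInter]
    exact D.mem_beta_iff
  rw [h]
  exact isClosed_iInter D.isClosed_add_vanishingAt

end C0Algebra

/-! ### `A^β` as an ideal of `M(A)`, with its action of `Z M(A)`. -/

section Ideal

variable {X : Type u} [TopologicalSpace X] {A : Type v} [NonUnitalCStarAlgebra A]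
  (D : C0Algebra X A) (μM : C(StoneCech X, ℂ) →⋆ₐ[ℂ] ZM A)

theorem C0Algebra.mul_mem_beta (m : 𝓜(ℂ, A)) {b : 𝓜(ℂ, A)} (hb : b ∈ D.beta μM) :
    m * b ∈ D.beta μM := fun x hx => by
  obtain ⟨a, h, hh, rfl⟩ := hb x hx
  exact ⟨m.fst a, m * h, ClosedIdeal.mul_left_mem _ m hh, by rw [mul_add, mul_coe_multiplier]⟩

theorem C0Algebra.beta_mul_mem (m : 𝓜(ℂ, A)) {b : 𝓜(ℂ, A)} (hb : b ∈ D.beta μM) :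
    b * m ∈ D.beta μM := fun x hx => by
  obtain ⟨a, h, hh, rfl⟩ := hb x hx
  exact ⟨m.snd a, h * m, ClosedIdeal.mul_right_mem _ m hh, by rw [add_mul, coe_multiplier_mul]⟩

end Ideal

namespace C0Algebra

variable {X : Type u} [TopologicalSpace X] {A : Type v} [NonUnitalCStarAlgebra A]
  (D : C0Algebra X A)

section CentralAction

variable (μM : C(StoneCech X, ℂ) →⋆ₐ[ℂ] ZM A)

/-- The multiplication by `z` on `A^β`. -/
noncomputable def betaMulCLM (z : ZM A) : D.beta μM →L[ℂ] D.beta μM :=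
  LinearMap.mkContinuous
    { toFun := fun b => ⟨z * b, D.mul_mem_beta μM _ b.2⟩
      map_add' := fun _ _ => Subtype.ext (mul_add _ _ _)
      map_smul' := fun t _ => Subtype.ext (mul_smul_comm t _ _) }
    ‖(z : 𝓜(ℂ, A))‖ fun b => norm_mul_le (z : 𝓜(ℂ, A)) b

theorem coe_betaMulCLM (z : ZM A) (b : D.beta μM) :
    (D.betaMulCLM μM z b : 𝓜(ℂ, A)) = z * b := rfl

theorem betaMulCLM_mul (z : ZM A) (b c : D.beta μM) :
    D.betaMulCLM μM z (b * c) = D.betaMulCLM μM z b * c :=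
  Subtype.ext (mul_assoc _ _ _).symm

theorem mul_betaMulCLM (z : ZM A) (b c : D.beta μM) :
    b * D.betaMulCLM μM z c = D.betaMulCLM μM z (b * c) := by
  refine Subtype.ext ?_
  change (b : 𝓜(ℂ, A)) * (z * c) = z * (b * c)
  rw [← mul_assoc, ZM.comm, mul_assoc]

/-- The multiplication by `z` on `A^β` as a central multiplier. -/
noncomputable def betaMultiplier (z : ZM A) : ZM (D.beta μM) :=
  ⟨⟨(D.betaMulCLM μM z, D.betaMulCLM μM z), fun b c => by
      change D.betaMulCLM μM z b * c = b * D.betaMulCLM μM z c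
      rw [mul_betaMulCLM, betaMulCLM_mul]⟩,
    Subalgebra.mem_center_iff.2 fun n => doubleCentralizer_ext_fst fun b => by
      change n.fst (D.betaMulCLM μM z b) = D.betaMulCLM μM z (n.fst b)
      rw [← sub_eq_zero, ← CStarRing.star_mul_self_eq_zero_iff]
      have h : ∀ d, d * (n.fst (D.betaMulCLM μM z b) - D.betaMulCLM μM z (n.fst b)) = 0 :=
        fun d => by
          rw [mul_sub, ← n.central, mul_betaMulCLM, mul_betaMulCLM, n.central, sub_self]
      exact h _⟩

theorem cmul_betaMultiplier (z : ZM A) (b : D.beta μM) :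
    ZM.cmul (D.betaMultiplier μM z) b = D.betaMulCLM μM z b := rfl

/-- The action of `Z M(A)` on `A^β`. -/
noncomputable def centralAction : ZM A →⋆ₐ[ℂ] ZM (D.beta μM) where
  toFun := D.betaMultiplier μM
  map_one' := ZM.ext_cmul fun b => Subtype.ext (one_mul _)
  map_zero' := ZM.ext_cmul fun b => Subtype.ext (zero_mul _)
  map_add' z z' := ZM.ext_cmul fun b => Subtype.ext (add_mul _ _ _)
  map_mul' z z' := ZM.ext_cmul fun b => Subtype.ext (mul_assoc _ _ _)
  commutes' r := ZM.ext_cmul fun b => Subtype.ext (by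
    rw [cmul_betaMultiplier, coe_betaMulCLM]
    exact (Algebra.smul_def r (b : 𝓜(ℂ, A))).symm)
  map_star' z := ZM.ext_cmul fun b => by
    have h := ZM.star_cmul (D.betaMultiplier μM z) (star b)
    rw [star_star] at h
    rw [← h]
    refine Subtype.ext ?_
    change star (z : 𝓜(ℂ, A)) * b = star ((z : 𝓜(ℂ, A)) * star (b : 𝓜(ℂ, A)))
    rw [star_mul, star_star]
    exact (ZM.comm (star z) b).symm

theorem coe_cmul_centralAction (z : ZM A) (b : D.beta μM) :
    ((ZM.cmul (D.centralAction μM z) b : D.beta μM) : 𝓜(ℂ, A)) = z * b := rfl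

/-- The inclusion of `A^β` into `M(A)`. -/
def betaCoe : D.beta μM →ₗ[ℂ] 𝓜(ℂ, A) where
  toFun b := b
  map_add' _ _ := rfl
  map_smul' _ _ := rfl

theorem centralAction_toBeta (z : ZM A) (a : A) :
    ZM.cmul (D.centralAction μM z) (D.toBeta μM a) = D.toBeta μM (ZM.cmul z a) :=
  Subtype.ext (mul_coe_multiplier _ _)

theorem toBeta_injective : Function.Injective (D.toBeta μM) := fun a b h => by
  have h1 : ((a - b : A) : 𝓜(ℂ, A)) = 0 := by
    rw [coe_multiplier_sub, sub_eq_zero]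
    exact congrArg Subtype.val h
  rwa [← norm_eq_zero, norm_coe_multiplier, norm_eq_zero, sub_eq_zero] at h1

/-- The action is already faithful on `A ⊆ A^β`. -/
theorem centralAction_injective : Function.Injective (D.centralAction μM) := fun z z' h =>
  ZM.ext_cmul fun a => D.toBeta_injective μM (by
    rw [← centralAction_toBeta, ← centralAction_toBeta, h])

theorem mul_toBeta (b : D.beta μM) (a : A) :
    b * D.toBeta μM a = D.toBeta μM ((b : 𝓜(ℂ, A)).fst a) :=
  Subtype.ext (mul_coe_multiplier _ _)

theorem toBeta_mul (b : D.beta μM) (a : A) :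
    D.toBeta μM a * b = D.toBeta μM ((b : 𝓜(ℂ, A)).snd a) :=
  Subtype.ext (coe_multiplier_mul _ _)

theorem eq_zero_of_forall_mul_toBeta (b : D.beta μM) (h : ∀ a, b * D.toBeta μM a = 0) : b = 0 :=
  Subtype.ext (doubleCentralizer_ext_fst fun a => D.toBeta_injective μM (by
    rw [← mul_toBeta, h]
    exact (map_zero (D.toBeta μM)).symm))

end CentralAction

/-! ### Fibres of `A^β` over the points of `X_A`. -/

section Compactification

variable [T2Space X] [LocallyCompactSpace X] {K : Type w} [TopologicalSpace K] [CompactSpace K]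
  [T2Space K] {ι : D.XA → K} {μK : C(K, ℂ) →⋆ₐ[ℂ] ZM A}

/-- The structure map of `A^β` as a `C(K)`-algebra. -/
noncomputable abbrev betaStructureMap (μK : C(K, ℂ) →⋆ₐ[ℂ] ZM A) :
    C(K, ℂ) →⋆ₐ[ℂ] ZM (D.beta D.multiplierMap) := (D.centralAction D.multiplierMap).comp μK

theorem isCKAlgebra_beta (μK : C(K, ℂ) →⋆ₐ[ℂ] ZM A) : IsCKAlgebra (D.betaStructureMap μK) where
  compact := inferInstance
  t2 := inferInstance
  complete := D.isClosed_beta.completeSpace_coe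
  nondegenerate b := ⟨1, b, by rw [map_one]; rfl⟩

variable {D}

/-- The right side does not involve `K`, so all compactifications give the same fibres over `X_A`.
In the converse direction the approximants `f b` stay in `A^β`, since it is an ideal. -/
theorem mem_ckIdeal_beta_iff (hμ : D.IsBaseChange ι μK) (hι : IsInducing ι) (x : D.XA)
    {b : D.beta D.multiplierMap} :
    b ∈ (ckIdeal (D.betaStructureMap μK) (ι x)).toSubmodule ↔
      (b : 𝓜(ℂ, A)) ∈ D.vanishingAt x := by
  refine ⟨fun h => ?_, fun h => ?_⟩
  · have hcl : IsClosed ((D.vanishingAt x).comap (D.betaCoe D.multiplierMap) :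
        Set (D.beta D.multiplierMap)) :=
      (D.isClosed_vanishingAt x).preimage continuous_subtype_val
    have hle : (ckIdeal (D.betaStructureMap μK) (ι x)).toSubmodule ≤
        (D.vanishingAt x).comap (D.betaCoe D.multiplierMap) := by
      refine ckIdeal_le _ _ hcl fun f hf c => ?_
      rw [Submodule.mem_comap]
      exact mul_mem_vanishingAt hμ hι.continuous hf (c : 𝓜(ℂ, A))
    exact Submodule.mem_comap.1 (hle h)
  · refine (ClosedIdeal.closed _).closure_subset (Metric.mem_closure_iff.2 fun ε hε => ?_)
    obtain ⟨f, hf, hfm⟩ := exists_norm_sub_mul_le hμ hι h (half_pos hε)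
    refine ⟨_, cmul_mem_ckIdeal _ _ hf b, ?_⟩
    rw [dist_eq_norm]
    exact lt_of_le_of_lt hfm (half_lt_self hε)

theorem norm_proj_toBeta (hμ : D.IsBaseChange ι μK) (hι : IsInducing ι) (x : D.XA) (a : A) :
    ‖(ckIdeal (D.betaStructureMap μK) (ι x)).proj (D.toBeta D.multiplierMap a)‖ =
      ‖(D.J x).proj a‖ := by
  refine le_antisymm ?_ ?_ <;> refine le_of_forall_pos_le_add fun ε hε => ?_
  · obtain ⟨c, hc, hca⟩ := (D.J x).exists_mem_norm_sub_lt (lt_add_of_pos_right _ hε)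
    have h := ClosedIdeal.norm_proj_le_of_mem _ (D.toBeta D.multiplierMap a)
      ((mem_ckIdeal_beta_iff hμ hι x (b := D.toBeta D.multiplierMap c)).2
        (D.coe_mem_vanishingAt_iff.2 hc))
    rw [← map_sub] at h
    exact (h.trans_eq (norm_coe_multiplier _)).trans hca.le
  · obtain ⟨c, hc, hca⟩ := ClosedIdeal.exists_mem_norm_sub_lt _ (lt_add_of_pos_right
      ‖(ckIdeal (D.betaStructureMap μK) (ι x)).proj (D.toBeta D.multiplierMap a)‖ hε)
    exact (norm_proj_le_norm_sub hμ hι ((mem_ckIdeal_beta_iff hμ hι x).1 hc) a).trans hca.le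

theorem exists_sub_toBeta_mem (hμ : D.IsBaseChange ι μK) (hι : IsInducing ι) (x : D.XA)
    (b : D.beta D.multiplierMap) : ∃ a : A, b - D.toBeta D.multiplierMap a ∈
      (ckIdeal (D.betaStructureMap μK) (ι x)).toSubmodule := by
  obtain ⟨a, ha⟩ := D.mem_beta_iff.1 b.2 x
  exact ⟨a, (mem_ckIdeal_beta_iff hμ hι x).2 ha⟩

/-- The map of the fibres of `A` and `A^β`. -/
noncomputable def fibreMap (hμ : D.IsBaseChange ι μK) (hι : IsInducing ι) (x : D.XA) :
    (D.J x).Quot → (ckIdeal (D.betaStructureMap μK) (ι x)).Quot :=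
  Quotient.map (D.toBeta D.multiplierMap) fun a b hab => by
    replace hab : a - b ∈ (D.J x).toSubmodule := (Submodule.quotientRel_def _).1 hab
    refine (Submodule.quotientRel_def _).2 ?_
    rw [← map_sub]
    exact (mem_ckIdeal_beta_iff hμ hι x).2 (D.coe_mem_vanishingAt_iff.2 hab)

theorem fibreMap_proj (hμ : D.IsBaseChange ι μK) (hι : IsInducing ι) (x : D.XA) (a : A) :
    fibreMap hμ hι x ((D.J x).proj a) =
      (ckIdeal (D.betaStructureMap μK) (ι x)).proj (D.toBeta D.multiplierMap a) := rfl

/-- Injectivity is `A ∩ H_x = J_x`; surjectivity is `A^β ⊆ A + H_x`. -/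
theorem fibreMap_bijective (hμ : D.IsBaseChange ι μK) (hι : IsInducing ι) (x : D.XA) :
    Function.Bijective (fibreMap hμ hι x) := by
  refine ⟨fun p q h => ?_, fun q => ?_⟩
  · obtain ⟨a, rfl⟩ := ClosedIdeal.proj_surjective _ p
    obtain ⟨b, rfl⟩ := ClosedIdeal.proj_surjective _ q
    rw [fibreMap_proj, fibreMap_proj, ClosedIdeal.proj_eq_proj_iff, ← map_sub,
      mem_ckIdeal_beta_iff hμ hι] at h
    exact (ClosedIdeal.proj_eq_proj_iff _).2 (D.coe_mem_vanishingAt_iff.1 h)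
  · obtain ⟨b, rfl⟩ := ClosedIdeal.proj_surjective _ q
    obtain ⟨a, ha⟩ := exists_sub_toBeta_mem hμ hι x b
    exact ⟨(D.J x).proj a, ((ClosedIdeal.proj_eq_proj_iff _).2 ha).symm⟩

/-- The isomorphism of the fibres of `A` and `A^β`. -/
noncomputable def fibreEquiv (hμ : D.IsBaseChange ι μK) (hι : IsInducing ι) (x : D.XA) :
    (D.J x).Quot ≃⋆ₐ[ℂ] (ckIdeal (D.betaStructureMap μK) (ι x)).Quot where
  toEquiv := Equiv.ofBijective _ (fibreMap_bijective hμ hι x)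
  map_mul' p q := by
    obtain ⟨a, rfl⟩ := ClosedIdeal.proj_surjective _ p
    obtain ⟨b, rfl⟩ := ClosedIdeal.proj_surjective _ q
    exact congrArg _ (map_mul (D.toBeta D.multiplierMap) a b)
  map_add' p q := by
    obtain ⟨a, rfl⟩ := ClosedIdeal.proj_surjective _ p
    obtain ⟨b, rfl⟩ := ClosedIdeal.proj_surjective _ q
    exact congrArg _ (map_add (D.toBeta D.multiplierMap) a b)
  map_star' p := by
    obtain ⟨a, rfl⟩ := ClosedIdeal.proj_surjective _ p
    exact congrArg _ (map_star (D.toBeta D.multiplierMap) a)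
  map_smul' t p := by
    obtain ⟨a, rfl⟩ := ClosedIdeal.proj_surjective _ p
    exact congrArg _ (map_smul (D.toBeta D.multiplierMap) t a)

theorem isCompactification_beta (hμ : D.IsBaseChange ι μK) (hι : IsDenseEmbedding ι) :
    D.IsCompactification ι μK (D.betaStructureMap μK) (D.toBeta D.multiplierMap) where
  isCKAlgebra := D.isCKAlgebra_beta μK
  isDenseEmbedding := hι
  isBaseChange := hμ
  injective := D.toBeta_injective _
  linear _ a := (D.centralAction_toBeta _ _ a).symm
  ideal_left b a := ⟨_, (D.mul_toBeta _ b a).symm⟩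
  ideal_right b a := ⟨_, (D.toBeta_mul _ b a).symm⟩
  essential := D.eq_zero_of_forall_mul_toBeta _
  fibre x := ⟨fibreEquiv hμ hι.isInducing x, fun _ => rfl⟩

end Compactification

/-! ### Continuity of the fibre norms of `A^β`. -/

section Continuity

variable [T2Space X] [LocallyCompactSpace X] {K : Type w} [TopologicalSpace K] [CompactSpace K]
  [T2Space K] {ι : D.XA → K} {μK : C(K, ℂ) →⋆ₐ[ℂ] ZM A}

variable {D}

/-- Points of `X_A` suffice because the norm of `b` is that of its action on `A`, and `‖(b a)(x)‖ ≤
‖b(x)‖ ‖a‖`. -/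
theorem norm_le_of_forall_norm_beta_proj_le (hμ : D.IsBaseChange ι μK) (hι : IsInducing ι)
    {b : D.beta D.multiplierMap} {α : ℝ} (hα : 0 ≤ α)
    (h : ∀ x, ‖(ckIdeal (D.betaStructureMap μK) (ι x)).proj b‖ ≤ α) : ‖b‖ ≤ α := by
  change ‖(b : 𝓜(ℂ, A))‖ ≤ α
  rw [← DoubleCentralizer.norm_fst]
  refine ContinuousLinearMap.opNorm_le_bound _ hα fun a => ?_
  refine D.norm_le_of_forall_norm_proj_le (by positivity) fun x => ?_
  rw [← norm_proj_toBeta hμ hι, ← mul_toBeta]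
  refine (ClosedIdeal.norm_proj_mul_le _ _ _).trans (mul_le_mul (h x) ?_ (norm_nonneg _) hα)
  exact (norm_coe_multiplier a).le

/-- Choose `a ∈ A` with the same fibre as `b` at `x`. Upper semicontinuity keeps `b - a` small near
`x`, so `‖b(y)‖` is close to the continuous function `‖a(y)‖` there. -/
theorem continuous_norm_beta_proj (hμ : D.IsBaseChange ι μK) (hι : IsInducing ι)
    (hD : D.IsContinuous) (b : D.beta D.multiplierMap) :
    Continuous fun x => ‖(ckIdeal (D.betaStructureMap μK) (ι x)).proj b‖ := by
  refine continuous_iff_continuousAt.2 fun x => Metric.continuousAt_iff'.2 fun ε hε => ?_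
  obtain ⟨a, ha⟩ := exists_sub_toBeta_mem hμ hι x b
  have h0 : ‖(ckIdeal (D.betaStructureMap μK) (ι x)).proj (b - D.toBeta D.multiplierMap a)‖
      < ε / 3 := by
    rw [(ClosedIdeal.proj_eq_zero_iff _).2 ha, norm_zero]; positivity
  have h1 := hι.continuous.continuousAt.eventually (eventually_norm_ckIdeal_proj_lt _ h0)
  have hcont : ContinuousAt (fun y : D.XA => ‖(D.J y).proj a‖) x :=
    ((hD a).comp continuous_subtype_val).continuousAt
  have h2 := Metric.continuousAt_iff'.1 hcont (ε / 3) (by positivity)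
  have h3 : ∀ y, |‖(ckIdeal (D.betaStructureMap μK) (ι y)).proj b‖ - ‖(D.J y).proj a‖| ≤
      ‖(ckIdeal (D.betaStructureMap μK) (ι y)).proj (b - D.toBeta D.multiplierMap a)‖ := fun y => by
    rw [← norm_proj_toBeta hμ hι, ClosedIdeal.proj_sub]
    exact abs_norm_sub_norm_le _ _
  filter_upwards [h1, h2] with y hy1 hy2
  have hx3 := h3 x
  have hy3 := h3 y
  simp only [Real.dist_eq, abs_lt, abs_le] at *
  constructor <;> linarith

theorem isContinuousCK_beta (hD : D.IsContinuous) :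
    IsContinuousCK (D.betaStructureMap D.betaMap) := fun b => by
  have hμ := D.isBaseChange_betaMap
  have hι : IsInducing (stoneCechUnit : D.XA → _) := isInducing_stoneCechUnit
  set G : StoneCech D.XA → ℝ := fun y => ‖(ckIdeal (D.betaStructureMap D.betaMap) y).proj b‖
    with hG
  have hGb : ∀ x, G (stoneCechUnit x) ∈ Icc 0 ‖b‖ := fun x =>
    ⟨norm_nonneg _, ClosedIdeal.norm_proj_le _ _⟩
  have hc : Continuous fun x => (⟨G (stoneCechUnit x), hGb x⟩ : Icc 0 ‖b‖) :=
    (continuous_norm_beta_proj hμ hι hD b).subtype_mk _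
  have hgc : Continuous fun y => (stoneCechExtend hc y).1 :=
    continuous_subtype_val.comp (continuous_stoneCechExtend hc)
  have hgx : ∀ x, (stoneCechExtend hc (stoneCechUnit x)).1 = G (stoneCechUnit x) := fun x =>
    congrArg Subtype.val (stoneCechExtend_stoneCechUnit hc x)
  have key : G = fun y => (stoneCechExtend hc y).1 := by
    funext y
    refine le_antisymm (le_of_forall_gt_imp_ge_of_dense fun r hr => ?_) ?_
    · have hr0 : 0 ≤ r := (stoneCechExtend hc y).2.1.trans hr.le
      -- The cut-off `h` is `1` at `y` and vanishes where the extension is at least `r`. Over `X_A`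
      -- the fibres of `h b` have norm at most `r`, so `‖h b‖ ≤ r`; and `h b` has the same fibre as
      -- `b` at `y`.
      obtain ⟨h, h0, h1, h01⟩ := exists_continuous_zero_one_of_isClosed
        (isClosed_le continuous_const hgc : IsClosed {z | r ≤ (stoneCechExtend hc z).1})
        (isClosed_singleton (x := y)) (disjoint_singleton_right.2 (not_le.2 hr))
      set B := D.betaStructureMap D.betaMap
      have h2 : ‖ZM.cmul (B (complexify h)) b‖ ≤ r :=
        norm_le_of_forall_norm_beta_proj_le hμ hι hr0 fun x => by
          rw [ckIdeal_proj_cmul, ← ClosedIdeal.proj_smul, ClosedIdeal.norm_proj_smul]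
          rcases le_or_gt r (stoneCechExtend hc (stoneCechUnit x)).1 with hx | hx
          · rw [complexify_apply, h0 hx]
            simpa using hr0
          · have h3 : ‖complexify h (stoneCechUnit x)‖ ≤ 1 :=
              ((complexify h).norm_coe_le_norm _).trans (norm_complexify_le h01)
            rw [hgx] at hx
            exact (mul_le_of_le_one_left (norm_nonneg _) h3).trans hx.le
      have h4 : (ckIdeal B y).proj (ZM.cmul (B (complexify h)) b) = (ckIdeal B y).proj b := by
        rw [ckIdeal_proj_cmul, complexify_apply, h1 rfl, ← ClosedIdeal.proj_smul]
        simp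
      exact (h4 ▸ ClosedIdeal.norm_proj_le _ _).trans h2
    -- If the extension exceeded `G y`, upper semicontinuity of `G` would separate the two by `r`
    -- near `y`, hence at a point of the dense subset `X_A`, where they agree.
    · by_contra! hlt
      obtain ⟨r, hr1, hr2⟩ := exists_between hlt
      have h1 : ∀ᶠ z in 𝓝 y, G z < r := eventually_norm_ckIdeal_proj_lt _ hr1
      have h2 : ∀ᶠ z in 𝓝 y, r < (stoneCechExtend hc z).1 :=
        hgc.continuousAt.eventually (lt_mem_nhds hr2)
      obtain ⟨V, hV, hVo, hyV⟩ := eventually_nhds_iff.1 (h1.and h2)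
      obtain ⟨x, hx⟩ := denseRange_stoneCechUnit.exists_mem_open hVo ⟨y, hyV⟩
      obtain ⟨h3, h4⟩ := hV _ hx
      rw [hgx] at h4
      exact lt_asymm h3 h4
  change Continuous G
  rw [key]
  exact hgc

end Continuity

end C0Algebra

end BundleCompactification

end

theorem theoremt {X : Type*} [TopologicalSpace X] [LocallyCompactSpace X] [T2Space X]
    {A : Type*} [NonUnitalCStarAlgebra A] (D : C0Algebra X A) :
    ∃ (μM : C(StoneCech X, ℂ) →⋆ₐ[ℂ] ZM A) (ν : C(StoneCech D.XA, ℂ) →⋆ₐ[ℂ] ZM A),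
      -- `μM` is the unique extension of the structure map of `A` to `C(βX)`
      (D.Extends μM ∧ ∀ μM', D.Extends μM' → μM' = μM) ∧
      -- `ν` is the canonical structure map of `A` as a `C(βX_A)`-algebra
      (D.IsBaseChange stoneCechUnit ν ∧ ∀ ν', D.IsBaseChange stoneCechUnit ν' → ν' = ν) ∧
      -- `A^β` is a closed ideal of `M(A)`
      (IsClosed (D.beta μM : Set 𝓜(ℂ, A)) ∧
        ∀ m : 𝓜(ℂ, A), ∀ b ∈ D.beta μM, m * b ∈ D.beta μM ∧ b * m ∈ D.beta μM) ∧
      ∃ π : ZM A →⋆ₐ[ℂ] ZM (D.beta μM),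
        -- `π` is injective, and `π z` acts on `A^β` as `z` does
        (Function.Injective π ∧
          ∀ (z : ZM A) (b : D.beta μM), ((ZM.cmul (π z) b : D.beta μM) : 𝓜(ℂ, A)) = z * b) ∧
        -- with the structure map `π ∘ ν`, `A^β` is a `C(βX_A)`-algebra and a compactification of `A`
        IsCKAlgebra (π.comp ν) ∧
        D.IsCompactification stoneCechUnit ν (π.comp ν) (D.toBeta μM) ∧
        -- for every compactification `K` of `X_A`, it is a `C(K)`-algebra by restriction to `C(K)`
        (∀ (K : Type*) [TopologicalSpace K] [CompactSpace K] [T2Space K] (ι : D.XA → K)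
          (hι : IsDenseEmbedding ι),
          IsCKAlgebra ((π.comp ν).comp (D.restrictToBeta hι.continuous)) ∧
          -- and with this structure it is a compactification of `A`
          D.IsCompactification ι (ν.comp (D.restrictToBeta hι.continuous))
            ((π.comp ν).comp (D.restrictToBeta hι.continuous)) (D.toBeta μM)) ∧
        -- if `A` is continuous and `X_A = X`, then `A^β` is a continuous `C(βX)`-algebra
        (D.IsContinuous → D.XA = Set.univ → IsContinuousCK (π.comp ν)) := by
  have hι : IsDenseEmbedding (stoneCechUnit : D.XA → StoneCech D.XA) :=
    -- Complete regularity passes from `X` to its subspace `X_A`, which therefore embeds in `βX_A`.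
    haveI : T35Space D.XA := {}
    isDenseEmbedding_stoneCechUnit
  exact ⟨D.multiplierMap, D.betaMap, ⟨D.extends_multiplierMap, fun _ h => D.eq_multiplierMap h⟩,
    ⟨D.isBaseChange_betaMap, fun _ h => D.eq_betaMap h⟩,
    ⟨D.isClosed_beta, fun m b hb => ⟨D.mul_mem_beta _ m hb, D.beta_mul_mem _ m hb⟩⟩,
    D.centralAction D.multiplierMap,
    ⟨D.centralAction_injective _, D.coe_cmul_centralAction _⟩,
    D.isCKAlgebra_beta D.betaMap,
    C0Algebra.isCompactification_beta D.isBaseChange_betaMap hι,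
    fun K _ _ _ ι hι => by
      rw [StarAlgHom.comp_assoc]
      exact ⟨D.isCKAlgebra_beta _,
        C0Algebra.isCompactification_beta (D.isBaseChange_restrict hι.continuous) hι⟩,
    fun hD _ => C0Algebra.isContinuousCK_beta hD⟩
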